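/- Let $\lambda$ be the uniform probability measure on $[0,1]$ and let $[0,1]^{\mathbb N}$ carry the product measure $\lambda^{\mathbb N}$; $\mathrm{Var}$, $\mathbb E$ and $\|\cdot\|_1$ refer to $\lambda^{\mathbb N}$. For $f\in L^2(\lambda^{\mathbb N})$ and $i\in\mathbb N$ put $\Delta_i f = f-\int f\,d\lambda(x_i)$, the function minus its average over the $i$-th coordinate. A function $h$ on $[0,1]^{\mathbb N}$ is called a weak partial derivative $\partial f/\partial x_i$ of $f$ if for almost every choice of the coordinates $x_j$, $j\ne i$, the one-variable functions $x_i\mapsto f(x)$ and $x_i\mapsto h(x)$ are locally integrable on $(0,1)$ and $$\int_0^1 g'(x_i)\,f(x)\,dx_i=-\int_0^1 g(x_i)\,h(x)\,dx_i$$ for every smooth function $g$ with compact support in $(0,1)$. Suppose that $f\in L^2(\lambda^{\mathbb N})$ has, for every $i\in\mathbb N$, a weak partial derivative $\frac{\partial f}{\partial x_i}\in L^2(\lambda^{\mathbb N})$. Then $$\mathrm{Var}(f)\,\log\frac{\mathrm{Var}(f)}{\sum_{i\in\mathbb N}\|\Delta_i f\|_1^2}\;\le\;\frac{2}{\pi^2}\sum_{i\in\mathbb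 N}\mathbb E\left(\left(\frac{\partial f}{\partial x_i}\right)^2\right).$$ The inequality is understood in $[-\infty,+\infty]$: the two series are sums in $[0,+\infty]$, $\log 0=-\infty$, and the left-hand side is $0$ if $\mathrm{Var}(f)=0$. -/

import Mathlib

open MeasureTheory ProbabilityTheory Set
open scoped unitInterval ENNReal ContDiff

/-- The infinite product probability measure on `[0,1]^ℕ` all of whose factors are the uniform
probability measure on `[0,1]`. -/
noncomputable def uniformProd : Measure (ℕ → I) :=
  Measure.infinitePi fun _ : ℕ => (volume : Measure I)

/-- `u'` is a weak derivative of `u` on `[0,1]`: both are locally integrable on `(0,1)` and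
`∫ g' u = - ∫ g u'` for every smooth `g : ℝ → ℝ` whose support is a compact subset of `(0,1)`. -/
def HasWeakDerivUnit (u u' : I → ℝ) : Prop :=
  LocallyIntegrableOn u (Ioo (0 : I) 1) ∧
  LocallyIntegrableOn u' (Ioo (0 : I) 1) ∧
  ∀ g : ℝ → ℝ, ContDiff ℝ ∞ g → HasCompactSupport g → tsupport g ⊆ Ioo (0 : ℝ) 1 →
    ∫ t : I, deriv g t * u t = - ∫ t : I, g t * u' t

/-- `h` is a weak partial derivative of `f` in the `i`-th coordinate: for almost every point `x`,
the function `f` with all coordinates but the `i`-th frozen at those of `x` has a weak derivative,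
given by `h` with the same coordinates frozen. (The condition does not depend on `x i`.) -/
def HasWeakPartialDeriv (i : ℕ) (f h : (ℕ → I) → ℝ) : Prop :=
  ∀ᵐ x ∂uniformProd,
    HasWeakDerivUnit (fun t => f (Function.update x i t)) (fun t => h (Function.update x i t))

/-- `Δ_i f = f - ∫ f dλ(x_i)`: the function minus its average over the `i`-th coordinate. -/
noncomputable def coordDelta (i : ℕ) (f : (ℕ → I) → ℝ) (x : ℕ → I) : ℝ :=
  f x - ∫ t : I, f (Function.update x i t)

/-!
The uniform measure on `[0, 1]` satisfies a logarithmic Sobolev inequality with constant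
`2 / π ^ 2`: for a positive cosine polynomial in place of the squared function, the entropy minus
the Fisher information term increases to `0` along the Neumann heat flow. By duality the entropy of
`g ^ 2` is the supremum of `∫ g ^ 2 * h` over bounded `h` with `∫ exp h ≤ 1`; in this form the
inequality tensorizes to functions of finitely many coordinates, because such an `h` splits into a
sum of functions, one for each coordinate, that satisfy the constraint in that coordinate alone.

Following Falik and Samorodnitsky, the inequality is applied not to `f` but to its martingale
differences `d j`, the entropy of `d j ^ 2` being bounded below by `A * log θ + A - θ * b ^ 2` with
`A = ∫ d j ^ 2` and `b = ∫ |d j| ≤ ‖Δ_j f‖₁`, for one `θ > 0` common to all `j`. Both `∫ d j ^ 2`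
and the energies of the `d j` telescope, to `Var f` and to at most the energy of `f`, and
`θ = Var f / ∑ ‖Δ_i f‖₁ ^ 2` gives the theorem.
-/

section HeatFlow

open Filter Topology Real Polynomial

/-- The sum `∑ (kπ)^j c_k e^{-(kπ)²t} φ(kπx)`. For `φ = cos` and `j = 0` it is the solution at time
`t` of the Neumann heat equation on `[0,1]` with initial value `∑ c_k cos(kπx)`; differentiating in
`x` raises `j` by one and replaces `φ` by its derivative, so all derivatives of the solution are of
this form. -/
noncomputable def heatSum (φ : ℝ → ℝ) (c : ℕ →₀ ℝ) (j : ℕ) (t x : ℝ) : ℝ :=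
  ∑ k ∈ c.support, (k * π) ^ j * c k * exp (-(k * π) ^ 2 * t) * φ (k * π * x)

variable {φ φ' : ℝ → ℝ} (c : ℕ →₀ ℝ) (j : ℕ)

theorem hasDerivAt_heatSum_space (hφ : ∀ y, HasDerivAt φ (φ' y) y) (t x : ℝ) :
    HasDerivAt (heatSum φ c j t) (heatSum φ' c (j + 1) t x) x := by
  refine HasDerivAt.fun_sum fun k _ => ?_
  have h := ((hφ (k * π * x)).comp x ((hasDerivAt_id x).const_mul (k * π))).const_mul
    ((k * π) ^ j * c k * exp (-(k * π) ^ 2 * t))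
  exact h.congr_deriv (by ring)

theorem hasDerivAt_heatSum_time (φ : ℝ → ℝ) (t x : ℝ) :
    HasDerivAt (heatSum φ c j · x) (heatSum (fun y => -φ y) c (j + 2) t x) t := by
  refine HasDerivAt.fun_sum fun k _ => ?_
  have h := ((((hasDerivAt_id t).const_mul (-(k * π) ^ 2)).exp).const_mul
    ((k * π) ^ j * c k)).mul_const (φ (k * π * x))
  exact h.congr_deriv (by simp only [id, mul_one]; ring)

theorem continuous_heatSum (hφ : Continuous φ) :
    Continuous fun z : ℝ × ℝ => heatSum φ c j z.1 z.2 := by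
  unfold heatSum; fun_prop

theorem abs_heatSum_le (hφ : ∀ y, |φ y| ≤ 1) {t : ℝ} (ht : 0 ≤ t) (x : ℝ) :
    |heatSum φ c j t x| ≤ ∑ k ∈ c.support, |(k * π) ^ j * c k| := by
  refine (Finset.abs_sum_le_sum_abs _ _).trans (Finset.sum_le_sum fun k _ => ?_)
  rw [abs_mul, abs_mul _ (exp _), mul_assoc, abs_exp]
  have hexp : exp (-(k * π) ^ 2 * t) ≤ 1 :=
    exp_le_one_iff.2 (by nlinarith [sq_nonneg (k * π)])
  exact mul_le_of_le_one_right (abs_nonneg _) (mul_le_one₀ hexp (abs_nonneg _) (hφ _))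

theorem tendsto_heatSum (φ : ℝ → ℝ) (x : ℝ) :
    Tendsto (heatSum φ c j · x) atTop (𝓝 (0 ^ j * c 0 * φ 0)) := by
  have hterm : ∀ k ∈ c.support,
      Tendsto (fun t => (k * π) ^ j * c k * exp (-(k * π) ^ 2 * t) * φ (k * π * x)) atTop
        (𝓝 (if k = 0 then 0 ^ j * c 0 * φ 0 else 0)) := by
    intro k _
    split_ifs with hk
    · simp [hk]
    · have hexp : Tendsto (fun t : ℝ => exp (-(k * π) ^ 2 * t)) atTop (𝓝 0) :=
        tendsto_exp_atBot.comp (tendsto_id.const_mul_atTop_of_neg (by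
          have : 0 < (k * π) ^ 2 := by positivity
          linarith))
      simpa using (hexp.const_mul ((k * π) ^ j * c k)).mul_const (φ (k * π * x))
  have hsum : ∑ k ∈ c.support, (if k = 0 then 0 ^ j * c 0 * φ 0 else 0) = 0 ^ j * c 0 * φ 0 := by
    by_cases h0 : c 0 = 0 <;> simp [h0]
  exact hsum ▸ tendsto_finsetSum _ hterm

theorem integral_heatSum_cos (t : ℝ) : ∫ x in (0 : ℝ)..1, heatSum cos c 0 t x = c 0 := by
  have hcos : ∀ k : ℕ, ∫ x in (0 : ℝ)..1, cos (k * π * x) = if k = 0 then 1 else 0 := by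
    intro k
    split_ifs with hk
    · simp [hk]
    · rw [intervalIntegral.integral_comp_mul_left (fun y => cos y) (by positivity)]
      simp [sin_nat_mul_pi]
  unfold heatSum
  rw [intervalIntegral.integral_finsetSum fun k _ =>
    Continuous.intervalIntegrable (by fun_prop) _ _]
  simp only [intervalIntegral.integral_const_mul, hcos, mul_ite, mul_one, mul_zero,
    Finset.sum_ite_eq', Finsupp.mem_support_iff]
  by_cases h0 : c 0 = 0 <;> simp [h0]

theorem integral_cos_mul_add_gaussianReal (w x : ℝ) (v : NNReal) :
    ∫ y, cos (w * (x + y)) ∂gaussianReal 0 v = exp (-w ^ 2 * (v / 2)) * cos (w * x) := by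
  have hchar : charFun (gaussianReal 0 v) w = exp (-w ^ 2 * (v / 2)) := by
    rw [charFun_gaussianReal]
    push_cast
    congr 1
    ring
  have hexp : ∫ y, Complex.exp ((w * (x + y) : ℝ) * Complex.I) ∂gaussianReal 0 v
      = Complex.exp ((w * x : ℝ) * Complex.I) * exp (-w ^ 2 * (v / 2)) := by
    rw [← hchar, charFun_apply_real, ← integral_const_mul]
    refine integral_congr_ae (.of_forall fun y => ?_)
    simp only [← Complex.exp_add]
    congr 1
    push_cast
    ring
  have hint : Integrable (fun y : ℝ => Complex.exp ((w * (x + y) : ℝ) * Complex.I))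
      (gaussianReal 0 v) :=
    .of_bound (C := 1) (by fun_prop) (.of_forall fun y => (Complex.norm_exp_ofReal_mul_I _).le)
  have hre := (integral_re (𝕜 := ℂ) hint).trans (congrArg Complex.re hexp)
  simp only [RCLike.re_to_complex, Complex.exp_ofReal_mul_I_re, Complex.re_mul_ofReal] at hre
  rw [hre, mul_comm]

theorem heatSum_cos_eq_integral {t : ℝ} (ht : 0 ≤ t) (x : ℝ) :
    heatSum cos c 0 t x = ∫ y, heatSum cos c 0 0 (x + y) ∂gaussianReal 0 (2 * t).toNNReal := by
  unfold heatSum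
  rw [integral_finsetSum]
  · refine Finset.sum_congr rfl fun k _ => ?_
    rw [integral_const_mul, integral_cos_mul_add_gaussianReal, coe_toNNReal _ (by positivity),
      mul_div_cancel_left₀ t two_ne_zero]
    simp [mul_assoc]
  · exact fun k _ => .const_mul (.of_bound (C := 1) (by fun_prop)
      (.of_forall fun y => abs_cos_le_one _)) _

/-- The minimum principle. -/
theorem le_heatSum_cos {m : ℝ} (h : ∀ x, m ≤ heatSum cos c 0 0 x) {t : ℝ} (ht : 0 ≤ t) (x : ℝ) :
    m ≤ heatSum cos c 0 t x := by
  rw [heatSum_cos_eq_integral c ht]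
  have hint : Integrable (fun y => heatSum cos c 0 0 (x + y))
      (gaussianReal 0 (2 * t).toNNReal) := by
    refine .of_bound (C := ∑ k ∈ c.support, |(k * π) ^ 0 * c k|) ?_
      (.of_forall fun y => abs_heatSum_le c 0 abs_cos_le_one le_rfl _)
    exact ((continuous_heatSum c 0 continuous_cos).comp
      (by fun_prop : Continuous fun y => ((0 : ℝ), x + y))).aestronglyMeasurable
  calc m = ∫ _, m ∂gaussianReal 0 (2 * t).toNNReal := by simp
    _ ≤ _ := integral_mono (integrable_const _) hint fun y => h _

/-- The function `x ↦ P(cos πx)`. As `P` varies these are the cosine polynomials on `[0,1]`, in a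
form which is visibly stable under products. -/
noncomputable def cosEval (P : ℝ[X]) (x : ℝ) : ℝ := P.eval (cos (π * x))

theorem continuous_cosEval (P : ℝ[X]) : Continuous (cosEval P) := by
  unfold cosEval; fun_prop

theorem hasDerivAt_cosEval (P : ℝ[X]) (x : ℝ) :
    HasDerivAt (cosEval P) (sin (π * x) * cosEval (-(C π * derivative P)) x) x := by
  have h := (P.hasDerivAt (cos (π * x))).comp x (((hasDerivAt_id x).const_mul π).cos)
  exact h.congr_deriv (by simp [cosEval]; ring)

theorem exists_heatSum_cos_eq_cosEval (t : ℝ) : ∃ P, heatSum cos c 0 t = cosEval P := by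
  refine ⟨∑ k ∈ c.support, C (c k * exp (-(k * π) ^ 2 * t)) * Chebyshev.T ℝ k, funext fun x => ?_⟩
  simp only [heatSum, cosEval, eval_finsetSum, eval_mul, eval_C, Chebyshev.T_real_cos,
    Int.cast_natCast, mul_assoc, pow_zero, one_mul]

theorem exists_cosEval_eq_heatSum_cos (P : ℝ[X]) :
    ∃ c : ℕ →₀ ℝ, cosEval P = heatSum cos c 0 0 := by
  have hP : P ∈ Submodule.span ℝ (Set.range (Chebyshev.chebyshevTsequence ℝ)) := by
    rw [(Chebyshev.chebyshevTsequence ℝ).span fun k =>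
      isUnit_iff_ne_zero.2 (leadingCoeff_ne_zero.2 (Sequence.ne_zero _ k))]
    trivial
  obtain ⟨c, rfl⟩ := Finsupp.mem_span_range_iff_exists_finsupp.1 hP
  refine ⟨c, funext fun x => ?_⟩
  have hT : ∀ k, Chebyshev.chebyshevTsequence ℝ k = Chebyshev.T ℝ k := fun _ => rfl
  simp only [cosEval, heatSum, Finsupp.sum, eval_finsetSum, eval_smul, smul_eq_mul, hT,
    Chebyshev.T_real_cos, Int.cast_natCast, mul_zero, exp_zero, mul_one, mul_assoc, pow_zero,
    one_mul]

/-- The density `p² / (2π² f) - f log f` of the difference of the two sides of the logarithmic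
Sobolev inequality, at a point where the function has value `f` and derivative `p`. -/
noncomputable def fisherSubEntropy (f p : ℝ) : ℝ := p ^ 2 / f / (2 * π ^ 2) - f * log f

/-- The rate of change of `fisherSubEntropy f p` when `f` changes at rate `q` and `p` at rate
`r`. -/
noncomputable def fisherSubEntropyRate (f p q r : ℝ) : ℝ :=
  (2 * p * r / f - p ^ 2 * q / f ^ 2) / (2 * π ^ 2) - (log f + 1) * q

theorem hasDerivAt_fisherSubEntropy {f p : ℝ → ℝ} {q r t : ℝ} (hf : HasDerivAt f q t)
    (hp : HasDerivAt p r t) (h : f t ≠ 0) :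
    HasDerivAt (fun s => fisherSubEntropy (f s) (p s))
      (fisherSubEntropyRate (f t) (p t) q r) t := by
  refine ((((hp.pow 2).div hf h).div_const (2 * π ^ 2)).sub (hf.mul (hf.log h))).congr_deriv ?_
  simp only [fisherSubEntropyRate, Pi.pow_apply]
  field_simp
  push_cast
  ring

theorem continuousOn_fisherSubEntropy {α : Type*} [TopologicalSpace α] {f p : α → ℝ} {s : Set α}
    (hf : ContinuousOn f s) (hp : ContinuousOn p s) (h : ∀ z ∈ s, f z ≠ 0) :
    ContinuousOn (fun z => fisherSubEntropy (f z) (p z)) s :=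
  (((hp.pow 2).div hf h).div_const _).sub (hf.mul (hf.log h))

theorem continuousOn_fisherSubEntropyRate {α : Type*} [TopologicalSpace α] {f p q r : α → ℝ}
    {s : Set α} (hf : ContinuousOn f s) (hp : ContinuousOn p s) (hq : ContinuousOn q s)
    (hr : ContinuousOn r s) (h : ∀ z ∈ s, f z ≠ 0) :
    ContinuousOn (fun z => fisherSubEntropyRate (f z) (p z) (q z) (r z)) s := by
  have h2 : ∀ z ∈ s, f z ^ 2 ≠ 0 := fun z hz => pow_ne_zero 2 (h z hz)
  exact (((((continuousOn_const.mul hp).mul hr).div hf h).sub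
    (((hp.pow 2).mul hq).div (hf.pow 2) h2)).div_const _).sub
    (((hf.log h).add continuousOn_const).mul hq)

/-- Along the heat flow `fisherSubEntropyRate` is, up to the nonpositive term
`-fisherSubEntropyDefect`, the space derivative of this flux; here `s`, `c` are the sine and the
cosine of `πx`, and `p = sρ`. -/
noncomputable def fisherSubEntropyFlux (s c f p q ρ : ℝ) : ℝ :=
  (2 * (p * q) / f - p ^ 3 / f ^ 2 / 3 - 2 * π * (s * c * (ρ ^ 2 / f))) / (2 * π ^ 2)
    - (log f + 1) * p

/-- The gap between the space derivative of `fisherSubEntropyFlux` and `fisherSubEntropyRate`. -/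
noncomputable def fisherSubEntropyDefect (s f p ρ ρ' : ℝ) : ℝ :=
  (p ^ 4 / (6 * f ^ 3) + 2 * s ^ 2 * (ρ' - ρ * p / (2 * f)) ^ 2 / f) / (2 * π ^ 2)

theorem fisherSubEntropyDefect_nonneg {f : ℝ} (hf : 0 < f) (s p ρ ρ' : ℝ) :
    0 ≤ fisherSubEntropyDefect s f p ρ ρ' := by
  unfold fisherSubEntropyDefect; positivity

theorem hasDerivAt_fisherSubEntropyFlux {f p q ρ : ℝ → ℝ} {ρ' r x : ℝ}
    (hpρ : ∀ y, p y = sin (π * y) * ρ y) (hf : HasDerivAt f (p x) x) (hp : HasDerivAt p (q x) x)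
    (hq : HasDerivAt q r x) (hρ : HasDerivAt ρ ρ' x) (h : f x ≠ 0) :
    HasDerivAt
      (fun y => fisherSubEntropyFlux (sin (π * y)) (cos (π * y)) (f y) (p y) (q y) (ρ y))
      (fisherSubEntropyRate (f x) (p x) (q x) r
        + fisherSubEntropyDefect (sin (π * x)) (f x) (p x) (ρ x) ρ') x := by
  have hs : HasDerivAt (fun y => sin (π * y)) (π * cos (π * x)) x :=
    (((hasDerivAt_id x).const_mul π).sin).congr_deriv (by simp [mul_comm])
  have hc : HasDerivAt (fun y => cos (π * y)) (-(π * sin (π * x))) x :=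
    (((hasDerivAt_id x).const_mul π).cos).congr_deriv (by simp [mul_comm])
  have hqρ : q x = π * cos (π * x) * ρ x + sin (π * x) * ρ' :=
    hp.unique ((funext hpρ : p = _) ▸ hs.mul hρ)
  have hflux := (((((hp.mul hq).const_mul 2).div hf h).sub
    (((hp.pow 3).div (hf.pow 2) (pow_ne_zero 2 h)).div_const 3)).sub
    (((hs.mul hc).mul ((hρ.pow 2).div hf h)).const_mul (2 * π))).div_const (2 * π ^ 2) |>.sub
    (((hf.log h).add_const 1).mul hp)
  refine hflux.congr_deriv ?_
  simp only [fisherSubEntropyRate, fisherSubEntropyDefect, Pi.mul_apply, Pi.pow_apply,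
    Pi.div_apply, hqρ, hpρ x]
  field_simp
  push_cast
  ring

theorem integral_fisherSubEntropyRate_nonpos {f p q r ρ ρ' : ℝ → ℝ}
    (hpρ : ∀ x, p x = sin (π * x) * ρ x) (hf : ∀ x, HasDerivAt f (p x) x)
    (hp : ∀ x, HasDerivAt p (q x) x) (hq : ∀ x, HasDerivAt q (r x) x)
    (hρ : ∀ x, HasDerivAt ρ (ρ' x) x) (hr : Continuous r) (hρ' : Continuous ρ')
    (h : ∀ x, 0 < f x) :
    ∫ x in (0 : ℝ)..1, fisherSubEntropyRate (f x) (p x) (q x) (r x) ≤ 0 := by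
  have cf : Continuous f := continuous_iff_continuousAt.2 fun x => (hf x).continuousAt
  have cp : Continuous p := continuous_iff_continuousAt.2 fun x => (hp x).continuousAt
  have cq : Continuous q := continuous_iff_continuousAt.2 fun x => (hq x).continuousAt
  have cρ : Continuous ρ := continuous_iff_continuousAt.2 fun x => (hρ x).continuousAt
  have hne : ∀ x, f x ≠ 0 := fun x => (h x).ne'
  have cRate : Continuous fun x => fisherSubEntropyRate (f x) (p x) (q x) (r x) :=
    continuousOn_univ.1 (continuousOn_fisherSubEntropyRate cf.continuousOn cp.continuousOn
      cq.continuousOn hr.continuousOn fun x _ => hne x)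
  have cDefect : Continuous fun x =>
      fisherSubEntropyDefect (sin (π * x)) (f x) (p x) (ρ x) (ρ' x) := by
    unfold fisherSubEntropyDefect
    fun_prop (disch := intro x; have := h x; positivity)
  calc ∫ x in (0 : ℝ)..1, fisherSubEntropyRate (f x) (p x) (q x) (r x)
      ≤ ∫ x in (0 : ℝ)..1, (fisherSubEntropyRate (f x) (p x) (q x) (r x)
          + fisherSubEntropyDefect (sin (π * x)) (f x) (p x) (ρ x) (ρ' x)) :=
        intervalIntegral.integral_mono_on zero_le_one (cRate.intervalIntegrable _ _)
          ((cRate.add cDefect).intervalIntegrable _ _) fun x _ =>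
            le_add_of_nonneg_right (fisherSubEntropyDefect_nonneg (h x) _ _ _ _)
    _ = 0 := by
        rw [intervalIntegral.integral_eq_sub_of_hasDerivAt (fun x _ =>
          hasDerivAt_fisherSubEntropyFlux hpρ (hf x) (hp x) (hq x) (hρ x) (hne x))
          ((cRate.add cDefect).intervalIntegrable _ _)]
        simp [fisherSubEntropyFlux, hpρ]

/-- `fisherSubEntropy` evaluated along the heat flow started from `∑ c_k cos(kπx)`. -/
noncomputable def heatFisherSubEntropy (t x : ℝ) : ℝ :=
  fisherSubEntropy (heatSum cos c 0 t x) (heatSum (fun y => -sin y) c 1 t x)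

/-- The time derivative of `heatFisherSubEntropy`, expressed through the space derivatives of the
solution by means of the heat equation. -/
noncomputable def heatFisherSubEntropyRate (t x : ℝ) : ℝ :=
  fisherSubEntropyRate (heatSum cos c 0 t x) (heatSum (fun y => -sin y) c 1 t x)
    (heatSum (fun y => -cos y) c 2 t x) (heatSum sin c 3 t x)

variable {c}

theorem hasDerivAt_heatFisherSubEntropy {t x : ℝ} (h : heatSum cos c 0 t x ≠ 0) :
    HasDerivAt (heatFisherSubEntropy c · x) (heatFisherSubEntropyRate c t x) t := by
  have hp := hasDerivAt_heatSum_time c 1 (fun y => -sin y) t x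
  simp only [neg_neg] at hp
  exact hasDerivAt_fisherSubEntropy (hasDerivAt_heatSum_time c 0 cos t x) hp h

theorem continuousOn_heatFisherSubEntropyRate {s : Set (ℝ × ℝ)}
    (h : ∀ z ∈ s, heatSum cos c 0 z.1 z.2 ≠ 0) :
    ContinuousOn (fun z : ℝ × ℝ => heatFisherSubEntropyRate c z.1 z.2) s :=
  continuousOn_fisherSubEntropyRate (continuous_heatSum c 0 continuous_cos).continuousOn
    (continuous_heatSum c 1 continuous_sin.neg).continuousOn
    (continuous_heatSum c 2 continuous_cos.neg).continuousOn
    (continuous_heatSum c 3 continuous_sin).continuousOn h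

theorem integral_heatFisherSubEntropyRate_nonpos {t : ℝ} (h : ∀ x, 0 < heatSum cos c 0 t x) :
    ∫ x in (0 : ℝ)..1, heatFisherSubEntropyRate c t x ≤ 0 := by
  obtain ⟨P, hP⟩ := exists_heatSum_cos_eq_cosEval c t
  have hf := hasDerivAt_heatSum_space c 0 hasDerivAt_cos t
  refine integral_fisherSubEntropyRate_nonpos (ρ := cosEval (-(C π * derivative P)))
    (fun x => (hf x).unique (hP ▸ hasDerivAt_cosEval P x)) hf
    (hasDerivAt_heatSum_space c 1 (fun y => (hasDerivAt_sin y).neg) t)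
    (hasDerivAt_heatSum_space c 2 (fun y => (hasDerivAt_cos y).neg.congr_deriv (neg_neg _)) t)
    (hasDerivAt_cosEval _) ?_ ?_ h
  · exact (continuous_heatSum c 3 continuous_sin).comp (by fun_prop : Continuous fun x => (t, x))
  · exact (by fun_prop : Continuous fun x => sin (π * x)).mul (continuous_cosEval _)

theorem continuous_heatFisherSubEntropy {t : ℝ} (h : ∀ x, heatSum cos c 0 t x ≠ 0) :
    Continuous (heatFisherSubEntropy c t) :=
  continuousOn_univ.1 (continuousOn_fisherSubEntropy
    ((continuous_heatSum c 0 continuous_cos).comp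
      (by fun_prop : Continuous fun x => (t, x))).continuousOn
    ((continuous_heatSum c 1 continuous_sin.neg).comp
      (by fun_prop : Continuous fun x => (t, x))).continuousOn
    fun x _ => h x)

theorem antitoneOn_integral_heatFisherSubEntropy
    (h : ∀ t, 0 ≤ t → ∀ x, 0 < heatSum cos c 0 t x) :
    AntitoneOn (fun t => ∫ x in (0 : ℝ)..1, heatFisherSubEntropy c t x) (Ici 0) := by
  intro s hs t ht hst
  have hnonneg : ∀ u ∈ uIcc s t, 0 ≤ u := fun u hu => (le_inf hs ht).trans hu.1
  have hrate : ContinuousOn (fun z : ℝ × ℝ => heatFisherSubEntropyRate c z.1 z.2)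
      (uIcc s t ×ˢ univ) :=
    continuousOn_heatFisherSubEntropyRate fun z hz => (h z.1 (hnonneg _ hz.1) z.2).ne'
  have hint : ∀ u, 0 ≤ u → IntervalIntegrable (heatFisherSubEntropy c u) volume 0 1 :=
    fun u hu => (continuous_heatFisherSubEntropy fun x => (h u hu x).ne').intervalIntegrable _ _
  refine sub_nonpos.1 ?_
  calc (∫ x in (0 : ℝ)..1, heatFisherSubEntropy c t x)
        - ∫ x in (0 : ℝ)..1, heatFisherSubEntropy c s x
      = ∫ x in (0 : ℝ)..1, ∫ u in s..t, heatFisherSubEntropyRate c u x := by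
        rw [← intervalIntegral.integral_sub (hint t ht) (hint s hs)]
        refine intervalIntegral.integral_congr fun x _ => ?_
        refine (intervalIntegral.integral_eq_sub_of_hasDerivAt (fun u hu =>
          hasDerivAt_heatFisherSubEntropy (h u (hnonneg u hu) x).ne') ?_).symm
        exact (hrate.comp (by fun_prop : ContinuousOn (fun u => (u, x)) (uIcc s t))
          fun u hu => ⟨hu, mem_univ _⟩).intervalIntegrable
    _ = ∫ u in s..t, ∫ x in (0 : ℝ)..1, heatFisherSubEntropyRate c u x := by
        have hint2 : IntegrableOn (Function.uncurry (heatFisherSubEntropyRate c))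
            (uIcc s t ×ˢ uIcc 0 1) :=
          (hrate.mono (prod_mono_right (subset_univ _))).integrableOn_compact
            (isCompact_uIcc.prod isCompact_uIcc)
        exact (intervalIntegral_intervalIntegral_swap
          (hint2.mono_set (prod_mono uIoc_subset_uIcc uIoc_subset_uIcc))).symm
    _ ≤ 0 := by
        rw [intervalIntegral.integral_of_le hst]
        exact setIntegral_nonpos measurableSet_Ioc fun u hu =>
          integral_heatFisherSubEntropyRate_nonpos
            (h u (hnonneg u (Icc_subset_uIcc ⟨hu.1.le, hu.2⟩)))

theorem abs_log_le_of_mem_Icc {m M y : ℝ} (hm : 0 < m) (hy : y ∈ Icc m M) :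
    |log y| ≤ |log m| + |log M| := by
  have hlow := log_le_log hm hy.1
  have hup := log_le_log (hm.trans_le hy.1) hy.2
  rw [abs_le]
  constructor
  · linarith [neg_abs_le (log m), abs_nonneg (log M)]
  · linarith [le_abs_self (log M), abs_nonneg (log m)]

theorem abs_fisherSubEntropy_le {m M B f p : ℝ} (hm : 0 < m) (hf : f ∈ Icc m M) (hp : |p| ≤ B) :
    |fisherSubEntropy f p| ≤ B ^ 2 / m / (2 * π ^ 2) + M * (|log m| + |log M|) := by
  have hfpos : 0 < f := hm.trans_le hf.1
  refine (abs_sub _ _).trans (add_le_add ?_ ?_)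
  · rw [abs_of_nonneg (by positivity)]
    have hp2 : p ^ 2 ≤ B ^ 2 := sq_le_sq' (abs_le.1 hp).1 (abs_le.1 hp).2
    have := hf.1
    gcongr
  · rw [abs_mul, abs_of_pos hfpos]
    exact mul_le_mul hf.2 (abs_log_le_of_mem_Icc hm hf) (abs_nonneg _) (hfpos.le.trans hf.2)

theorem tendsto_integral_heatFisherSubEntropy {m : ℝ} (hm : 0 < m)
    (h : ∀ t, 0 ≤ t → ∀ x, m ≤ heatSum cos c 0 t x) :
    Tendsto (fun t => ∫ x in (0 : ℝ)..1, heatFisherSubEntropy c t x) atTop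
      (𝓝 (-(c 0 * log (c 0)))) := by
  have hc0 : Tendsto (heatSum cos c 0 · 0) atTop (𝓝 (c 0)) := by
    simpa using tendsto_heatSum c 0 cos 0
  have hpos : c 0 ≠ 0 :=
    (hm.trans_le (ge_of_tendsto hc0 (eventually_atTop.2 ⟨0, fun t ht => h t ht 0⟩))).ne'
  have hconst : -(c 0 * log (c 0)) = ∫ _ in (0 : ℝ)..1, -(c 0 * log (c 0)) := by simp
  rw [hconst]
  set M := ∑ k ∈ c.support, |(k * π) ^ 0 * c k|
  set B := ∑ k ∈ c.support, |(k * π) ^ 1 * c k|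
  refine intervalIntegral.tendsto_integral_filter_of_dominated_convergence
    (fun _ => B ^ 2 / m / (2 * π ^ 2) + M * (|log m| + |log M|)) ?_ ?_ (by simp) ?_
  · filter_upwards [eventually_ge_atTop 0] with t ht
    exact (continuous_heatFisherSubEntropy
      fun x => (hm.trans_le (h t ht x)).ne').aestronglyMeasurable
  · filter_upwards [eventually_ge_atTop 0] with t ht
    refine .of_forall fun x _ => abs_fisherSubEntropy_le hm ⟨h t ht x, ?_⟩ ?_
    · exact (le_abs_self _).trans (abs_heatSum_le c 0 abs_cos_le_one ht x)
    · exact abs_heatSum_le c 1 (fun y => (abs_neg (sin y)).trans_le (abs_sin_le_one y)) ht x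
  · refine .of_forall fun x _ => ?_
    have hf : Tendsto (heatSum cos c 0 · x) atTop (𝓝 (c 0)) := by
      simpa using tendsto_heatSum c 0 cos x
    have hp : Tendsto (heatSum (fun y => -sin y) c 1 · x) atTop (𝓝 0) := by
      simpa using tendsto_heatSum c 1 (fun y => -sin y) x
    have hlim := (((hp.pow 2).div hf hpos).div_const (2 * π ^ 2)).sub (hf.mul (hf.log hpos))
    simpa [heatFisherSubEntropy, fisherSubEntropy] using hlim

theorem neg_mul_log_le_integral_heatFisherSubEntropy {m : ℝ} (hm : 0 < m)
    (h : ∀ x, m ≤ heatSum cos c 0 0 x) :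
    -(c 0 * log (c 0)) ≤ ∫ x in (0 : ℝ)..1, heatFisherSubEntropy c 0 x := by
  have hflow : ∀ t, 0 ≤ t → ∀ x, m ≤ heatSum cos c 0 t x := fun t ht => le_heatSum_cos c h ht
  have hanti := antitoneOn_integral_heatFisherSubEntropy
    fun t ht x => hm.trans_le (hflow t ht x)
  exact le_of_tendsto (tendsto_integral_heatFisherSubEntropy hm hflow)
    (eventually_atTop.2 ⟨0, fun t ht => hanti self_mem_Ici ht ht⟩)

end HeatFlow

section Entropy

open Real Polynomial

/-- The entropy `∫ f log f dμ - (∫ f dμ) log (∫ f dμ)` of a nonnegative function `f` with respect to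
a probability measure `μ`. -/
noncomputable def funEntropy {α : Type*} [MeasurableSpace α] (μ : Measure α) (f : α → ℝ) : ℝ :=
  ∫ x, f x * log (f x) ∂μ - (∫ x, f x ∂μ) * log (∫ x, f x ∂μ)

theorem mul_le_mul_log_sub_add_mul_exp {f m : ℝ} (hf : 0 < f) (hm : 0 < m) (h : ℝ) :
    f * h ≤ f * log f - f * log m - f + m * exp h := by
  have hexp : exp (h + log m - log f) = m * exp h / f := by
    rw [exp_sub, exp_add, exp_log hf, exp_log hm, mul_comm]
  have hle := add_one_le_exp (h + log m - log f)
  rw [hexp, le_div_iff₀ hf] at hle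
  linarith

/-- The easy half of the variational formula for the entropy. -/
theorem integral_mul_le_funEntropy {α : Type*} [MeasurableSpace α] {μ : Measure α} {f h : α → ℝ}
    (hf : Integrable f μ) (hflog : Integrable (fun x => f x * log (f x)) μ)
    (hfh : Integrable (fun x => f x * h x) μ) (hexp : Integrable (fun x => exp (h x)) μ)
    (hexp1 : ∫ x, exp (h x) ∂μ ≤ 1) (hpos : ∀ x, 0 < f x) (hmean : 0 < ∫ x, f x ∂μ) :
    ∫ x, f x * h x ∂μ ≤ funEntropy μ f := by
  set m := ∫ x, f x ∂μ with hm
  have hflm : Integrable (fun x => f x * log (f x) - f x * log m) μ := hflog.sub (hf.mul_const _)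
  have hflmf : Integrable (fun x => f x * log (f x) - f x * log m - f x) μ := hflm.sub hf
  calc ∫ x, f x * h x ∂μ
      ≤ ∫ x, (f x * log (f x) - f x * log m - f x + m * exp (h x)) ∂μ :=
        integral_mono hfh (hflmf.add (hexp.const_mul _))
          fun x => mul_le_mul_log_sub_add_mul_exp (hpos x) hmean (h x)
    _ = ∫ x, f x * log (f x) ∂μ - m * log m - m + m * ∫ x, exp (h x) ∂μ := by
        rw [integral_add hflmf (hexp.const_mul _), integral_sub hflm hf,
          integral_sub hflog (hf.mul_const _),
          integral_mul_const, integral_const_mul, ← hm]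
    _ ≤ funEntropy μ f := by
        have := mul_le_of_le_one_right hmean.le hexp1
        rw [funEntropy, ← hm]
        linarith

theorem integral_unitInterval_eq_intervalIntegral (F : ℝ → ℝ) :
    ∫ t : I, F t = ∫ x in (0 : ℝ)..1, F x := by
  rw [intervalIntegral.integral_of_le zero_le_one, ← integral_Icc_eq_integral_Ioc]
  exact integral_subtype measurableSet_Icc F

theorem integrable_unitInterval_of_continuous {F : I → ℝ} (hF : Continuous F) : Integrable F :=
  hF.integrable_of_hasCompactSupport (.of_compactSpace F)

/-- The derivative of `x ↦ P(cos πx)`. -/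
noncomputable def cosEvalDeriv (P : ℝ[X]) (x : ℝ) : ℝ :=
  sin (π * x) * cosEval (-(C π * derivative P)) x

theorem continuous_cosEvalDeriv (P : ℝ[X]) : Continuous (cosEvalDeriv P) :=
  (by fun_prop : Continuous fun x => sin (π * x)).mul (continuous_cosEval _)

theorem funEntropy_cosEval_le (P : ℝ[X]) {m : ℝ} (hm : 0 < m) (h : ∀ x, m ≤ cosEval P x) :
    funEntropy volume (fun t : I => cosEval P t) ≤
      (∫ t : I, cosEvalDeriv P t ^ 2 / cosEval P t) / (2 * π ^ 2) := by
  obtain ⟨c, hc⟩ := exists_cosEval_eq_heatSum_cos P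
  have hderiv : ∀ x, heatSum (fun y => -sin y) c 1 0 x = cosEvalDeriv P x := fun x =>
    (hasDerivAt_heatSum_space c 0 hasDerivAt_cos 0 x).unique (hc ▸ hasDerivAt_cosEval P x)
  have hne : ∀ x, cosEval P x ≠ 0 := fun x => (hm.trans_le (h x)).ne'
  have hcont := continuous_cosEval P
  have hkey := neg_mul_log_le_integral_heatFisherSubEntropy hm (c := c) (by rwa [← hc])
  simp only [heatFisherSubEntropy, fisherSubEntropy, hderiv, ← hc] at hkey
  rw [intervalIntegral.integral_sub, intervalIntegral.integral_div] at hkey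
  · rw [funEntropy, integral_unitInterval_eq_intervalIntegral (cosEval P),
      integral_unitInterval_eq_intervalIntegral fun x => cosEval P x * log (cosEval P x),
      integral_unitInterval_eq_intervalIntegral fun x => cosEvalDeriv P x ^ 2 / cosEval P x,
      show ∫ x in (0 : ℝ)..1, cosEval P x = c 0 by rw [hc, integral_heatSum_cos]]
    linarith
  · exact ((((continuous_cosEvalDeriv P).pow 2).div hcont hne).div_const _).intervalIntegrable _ _
  · exact (hcont.mul (hcont.log hne)).intervalIntegrable _ _

theorem funEntropy_cosEval_sq_add_le (P : ℝ[X]) {ε : ℝ} (hε : 0 < ε) :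
    funEntropy volume (fun t : I => cosEval P t ^ 2 + ε) ≤
      2 / π ^ 2 * ∫ t : I, cosEvalDeriv P t ^ 2 := by
  have heval : ∀ x, cosEval (P ^ 2 + C ε) x = cosEval P x ^ 2 + ε := fun x => by simp [cosEval]
  have hderiv : ∀ x, cosEvalDeriv (P ^ 2 + C ε) x = 2 * cosEval P x * cosEvalDeriv P x :=
    fun x => by simp [cosEvalDeriv, cosEval, derivative_pow]; ring
  have hpos : ∀ x, 0 < cosEval P x ^ 2 + ε := fun x => by positivity
  have hc := continuous_cosEval P
  have hc' := continuous_cosEvalDeriv P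
  have hfisher : ∫ t : I, (2 * cosEval P t * cosEvalDeriv P t) ^ 2 / (cosEval P t ^ 2 + ε) ≤
      ∫ t : I, 4 * cosEvalDeriv P t ^ 2 := by
    refine integral_mono (integrable_unitInterval_of_continuous ?_)
      (integrable_unitInterval_of_continuous (by fun_prop)) fun t => ?_
    · exact Continuous.div (by fun_prop) (by fun_prop) fun t => (hpos t).ne'
    · dsimp only
      rw [div_le_iff₀ (hpos t)]
      nlinarith [mul_nonneg hε.le (sq_nonneg (cosEvalDeriv P t))]
  have hlsi := funEntropy_cosEval_le (P ^ 2 + C ε) hε fun x => by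
    rw [heval]; exact le_add_of_nonneg_left (sq_nonneg _)
  simp only [heval, hderiv] at hlsi
  calc _ ≤ _ := hlsi
    _ ≤ (∫ t : I, 4 * cosEvalDeriv P t ^ 2) / (2 * π ^ 2) := by gcongr
    _ = 2 / π ^ 2 * ∫ t : I, cosEvalDeriv P t ^ 2 := by
      rw [integral_const_mul]
      field_simp
      ring

/-- The dual form of the logarithmic Sobolev inequality: unlike the entropy, the left-hand side is a
quadratic form in the function, so it passes to `L²` limits and behaves well under integration. -/
theorem integral_cosEval_sq_mul_le (P : ℝ[X]) {h : I → ℝ} (hm : Measurable h) {B : ℝ}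
    (hb : ∀ t, |h t| ≤ B) (hexp : ∫ t, exp (h t) ≤ 1) :
    ∫ t : I, cosEval P t ^ 2 * h t ≤ 2 / π ^ 2 * ∫ t : I, cosEvalDeriv P t ^ 2 := by
  have hhi : Integrable h := .of_bound hm.aestronglyMeasurable B (.of_forall hb)
  have hei : Integrable fun t => exp (h t) :=
    .of_bound hm.exp.aestronglyMeasurable (exp B) (.of_forall fun t => by
      rw [norm_eq_abs, abs_exp]
      exact exp_le_exp.2 ((le_abs_self _).trans (hb t)))
  have hmul : ∀ {F : I → ℝ}, Continuous F → Integrable fun t => F t * h t := fun hF =>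
    (integrable_unitInterval_of_continuous hF).mul_bdd (c := B) hm.aestronglyMeasurable
      (.of_forall hb)
  have hc : Continuous fun t : I => cosEval P t :=
    (continuous_cosEval P).comp continuous_subtype_val
  have hreg : ∀ ε > 0, (∫ t : I, cosEval P t ^ 2 * h t) + ε * ∫ t, h t ≤
      2 / π ^ 2 * ∫ t : I, cosEvalDeriv P t ^ 2 := by
    intro ε hε
    have hpos : ∀ t : I, 0 < cosEval P t ^ 2 + ε := fun t => by positivity
    have hcε : Continuous fun t : I => cosEval P t ^ 2 + ε := by fun_prop
    have hi := integrable_unitInterval_of_continuous hcε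
    have hmean : 0 < ∫ t : I, (cosEval P t ^ 2 + ε) := calc
      0 < ∫ _ : I, ε := by simpa using hε
      _ ≤ _ := integral_mono (integrable_const _) hi fun t =>
        le_add_of_nonneg_left (sq_nonneg (cosEval P t))
    have hle := integral_mul_le_funEntropy hi (integrable_unitInterval_of_continuous
      (hcε.mul (hcε.log fun t => (hpos t).ne'))) (hmul hcε) hei hexp hpos hmean
    simp only [add_mul] at hle
    rw [integral_add (hmul (F := fun t : I => cosEval P t ^ 2) (by fun_prop)) (hhi.const_mul _),
      integral_const_mul] at hle
    exact hle.trans (funEntropy_cosEval_sq_add_le P hε)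
  have hlim : Filter.Tendsto (fun ε : ℝ => (∫ t : I, cosEval P t ^ 2 * h t) + ε * ∫ t, h t)
      (nhdsWithin 0 (Ioi 0)) (nhds ((∫ t : I, cosEval P t ^ 2 * h t) + 0 * ∫ t, h t)) :=
    (Continuous.tendsto (by fun_prop) 0).mono_left nhdsWithin_le_nhds
  rw [zero_mul, add_zero] at hlim
  exact le_of_tendsto hlim (Filter.eventually_of_mem self_mem_nhdsWithin hreg)

end Entropy

section WeakDerivative

open Filter Topology Real Polynomial

theorem exists_Icc_superset_of_isCompact_subset_Ioo {a b : ℝ} (hab : a < b) {K : Set ℝ}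
    (hK : IsCompact K) (hs : K ⊆ Ioo a b) : ∃ a' b', a < a' ∧ b' < b ∧ K ⊆ Icc a' b' := by
  rcases K.eq_empty_or_nonempty with rfl | hne
  · exact ⟨b, a, hab, hab, empty_subset _⟩
  · obtain ⟨a', ha', hmin⟩ := hK.exists_isLeast hne
    obtain ⟨b', hb', hmax⟩ := hK.exists_isGreatest hne
    exact ⟨a', b', (hs ha').1, (hs hb').2, fun x hx => ⟨hmin hx, hmax hx⟩⟩

theorem exists_contDiff_deriv_eq_of_integral_eq_zero {a b : ℝ} (hab : a < b) {ψ : ℝ → ℝ}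
    (hψ : ContDiff ℝ ∞ ψ) (hs : tsupport ψ ⊆ Ioo a b) (h0 : ∫ x in a..b, ψ x = 0) :
    ∃ g : ℝ → ℝ, ContDiff ℝ ∞ g ∧ HasCompactSupport g ∧ tsupport g ⊆ Ioo a b ∧ deriv g = ψ := by
  have hcomp : IsCompact (tsupport ψ) :=
    isCompact_Icc.of_isClosed_subset (isClosed_tsupport _) (hs.trans Ioo_subset_Icc_self)
  obtain ⟨a', b', ha, hb, hsub⟩ := exists_Icc_superset_of_isCompact_subset_Ioo hab hcomp hs
  have hzero : ∀ x y, (∀ z ∈ uIcc x y, z ∉ Icc a' b') → ∫ z in x..y, ψ z = 0 := fun x y h => by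
    rw [intervalIntegral.integral_congr (g := fun _ => 0) fun z hz =>
      image_eq_zero_of_notMem_tsupport fun hmem => h z hz (hsub hmem)]
    simp
  have hderiv : ∀ x, HasDerivAt (fun x => ∫ y in a..x, ψ y) (ψ x) x := fun x =>
    hψ.continuous.integral_hasStrictDerivAt a x |>.hasDerivAt
  have hd : deriv (fun x => ∫ y in a..x, ψ y) = ψ := funext fun x => (hderiv x).deriv
  have hsupp : tsupport (fun x => ∫ y in a..x, ψ y) ⊆ Icc a' b' := by
    refine closure_minimal (fun x hx => ?_) isClosed_Icc
    by_contra hmem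
    refine hx ?_
    rcases lt_or_ge x a' with hxa | hxa
    · exact hzero a x fun z hz hz' => absurd hz'.1 (not_le.2 (hz.2.trans_lt (max_lt ha hxa)))
    · have hxb : b' < x := not_le.1 fun hle => hmem ⟨hxa, hle⟩
      dsimp only
      rw [← intervalIntegral.integral_add_adjacent_intervals (b := b)
        (hψ.continuous.intervalIntegrable _ _) (hψ.continuous.intervalIntegrable _ _), h0, zero_add]
      exact hzero b x fun z hz hz' => absurd hz'.2 (not_le.2 ((lt_min hb hxb).trans_le hz.1))
  exact ⟨_, contDiff_infty_iff_deriv.2 ⟨fun x => (hderiv x).differentiableAt, by rwa [hd]⟩,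
    isCompact_Icc.of_isClosed_subset (isClosed_tsupport _) hsupp,
    hsupp.trans (Icc_subset_Ioo ha hb), hd⟩

theorem exists_contDiff_tsupport_subset_Ioo_integral_eq_one {a b : ℝ} (hab : a < b) :
    ∃ η : ℝ → ℝ, ContDiff ℝ ∞ η ∧ tsupport η ⊆ Ioo a b ∧ ∫ x in a..b, η x = 1 := by
  let bump : ContDiffBump ((a + b) / 2) := ⟨(b - a) / 8, (b - a) / 4, by linarith, by linarith⟩
  have hsupp : tsupport (bump.normed volume) ⊆ Ioo a b := by
    rw [bump.tsupport_normed_eq, Real.closedBall_eq_Icc]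
    exact Icc_subset_Ioo (by simp only [bump]; linarith) (by simp only [bump]; linarith)
  refine ⟨bump.normed volume, bump.contDiff_normed, hsupp, ?_⟩
  rw [intervalIntegral.integral_eq_integral_of_support_subset, bump.integral_normed]
  exact (subset_tsupport _).trans (hsupp.trans Ioo_subset_Ioc_self)

/-- The du Bois-Reymond lemma. -/
theorem exists_ae_eq_const_of_integral_deriv_mul_eq_zero {a b : ℝ} (hab : a < b) {w : ℝ → ℝ}
    (hw : IntervalIntegrable w volume a b)
    (h : ∀ g : ℝ → ℝ, ContDiff ℝ ∞ g → HasCompactSupport g → tsupport g ⊆ Ioo a b →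
      ∫ x in a..b, deriv g x * w x = 0) :
    ∃ c, ∀ᵐ x, x ∈ Ioo a b → w x = c := by
  obtain ⟨η, hη, hηs, hη1⟩ := exists_contDiff_tsupport_subset_Ioo_integral_eq_one hab
  set c := ∫ x in a..b, η x * w x with hc
  have hwc : IntervalIntegrable (fun x => w x - c) volume a b := hw.sub intervalIntegrable_const
  have hmul : ∀ {φ : ℝ → ℝ}, ContDiff ℝ ∞ φ →
      IntervalIntegrable (fun x => φ x * w x) volume a b := fun hφ =>
    hw.continuousOn_mul hφ.continuous.continuousOn
  refine ⟨c, (isOpen_Ioo.ae_eq_zero_of_integral_contDiff_smul_eq_zero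
    (f := fun x => w x - c) ?_ fun φ hφ _ hφs => ?_).mono fun x hx hmem => sub_eq_zero.1 (hx hmem)⟩
  · exact (hwc.1.mono_set Ioo_subset_Ioc_self).locallyIntegrableOn
  · set m := ∫ x in a..b, φ x with hm
    have hφi : IntervalIntegrable φ volume a b := hφ.continuous.intervalIntegrable _ _
    have hηi : IntervalIntegrable η volume a b := hη.continuous.intervalIntegrable _ _
    have hsupp : tsupport (fun x => φ x - m * η x) ⊆ Ioo a b :=
      (tsupport_sub _ _).trans (union_subset hφs
        ((tsupport_mul_subset_right (f := fun _ => m)).trans hηs))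
    obtain ⟨g, hg, hgc, hgs, hgd⟩ := exists_contDiff_deriv_eq_of_integral_eq_zero hab
      (hφ.sub (contDiff_const.mul hη)) hsupp (by
        rw [intervalIntegral.integral_sub hφi (hηi.const_mul m),
          intervalIntegral.integral_const_mul, hη1, ← hm, mul_one, sub_self])
    have htest := h g hg hgc hgs
    simp only [hgd, sub_mul, mul_assoc] at htest
    rw [intervalIntegral.integral_sub (hmul hφ) ((hmul hη).const_mul m),
      intervalIntegral.integral_const_mul, ← hc] at htest
    have hsmul : Function.support (fun x => φ x • (w x - c)) ⊆ Ioc a b :=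
      (Function.support_smul_subset_left _ _).trans
        ((subset_tsupport φ).trans (hφs.trans Ioo_subset_Ioc_self))
    rw [← intervalIntegral.integral_eq_integral_of_support_subset hsmul]
    simp only [smul_eq_mul, mul_sub]
    rw [intervalIntegral.integral_sub (hmul hφ) (hφi.mul_const c),
      intervalIntegral.integral_mul_const, ← hm, htest]

theorem intervalIntegrable_IccExtend {u : I → ℝ} (hu : Integrable u) :
    IntervalIntegrable (IccExtend zero_le_one u) volume (0 : ℝ) 1 := by
  rw [intervalIntegrable_iff_integrableOn_Icc_of_le zero_le_one,
    integrableOn_iff_comap_subtypeVal measurableSet_Icc]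
  exact hu.congr (.of_forall fun t => (IccExtend_val zero_le_one u t).symm)

theorem integral_deriv_mul_intervalIntegral_eq_neg {a b : ℝ} {v g : ℝ → ℝ}
    (hv : IntervalIntegrable v volume a b) (hg : ContDiff ℝ 1 g) (hb : g b = 0) :
    ∫ x in a..b, deriv g x * ∫ y in a..x, v y = -∫ x in a..b, g x * v x := by
  have hderiv : ∫ x in a..b, g x * deriv (fun x => ∫ y in a..x, v y) x =
      ∫ x in a..b, g x * v x :=
    intervalIntegral.integral_congr_ae (hv.ae_hasDerivAt_integral.mono fun x hx hmem => by
      rw [(hx (uIoc_subset_uIcc hmem) a left_mem_uIcc).deriv])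
  have hparts := (hg.contDiffOn.absolutelyContinuousOnInterval
    (a := a) (b := b)).integral_mul_deriv_eq_deriv_mul
      (hv.absolutelyContinuousOnInterval_intervalIntegral (c := a) left_mem_uIcc)
  rw [hderiv] at hparts
  simp only [hb, intervalIntegral.integral_same, zero_mul, mul_zero, sub_zero, zero_sub] at hparts
  rw [hparts, neg_neg]

theorem ae_unitInterval_of_ae_Ioo {p : ℝ → Prop} (h : ∀ᵐ x : ℝ, x ∈ Ioo (0 : ℝ) 1 → p x) :
    ∀ᵐ t : I, p t := by
  have hI : ∀ᵐ t : I, (t : ℝ) ∈ Ioo (0 : ℝ) 1 → p t :=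
    unitInterval.measurePreserving_coe.quasiMeasurePreserving.ae (ae_restrict_of_ae h)
  have h0 : ∀ᵐ t : I, t ≠ 0 := by simp [ae_iff]
  have h1 : ∀ᵐ t : I, t ≠ 1 := by simp [ae_iff]
  filter_upwards [hI, h0, h1] with t ht ht0 ht1
  exact ht ⟨unitInterval.pos_iff_ne_zero.2 ht0, unitInterval.lt_one_iff_ne_one.2 ht1⟩

theorem HasWeakDerivUnit.exists_ae_eq_add_integral {u v : I → ℝ} (hu : Integrable u)
    (hv : Integrable v) (h : HasWeakDerivUnit u v) :
    ∃ c, ∀ᵐ t : I, u t = c + ∫ x in (0 : ℝ)..t, IccExtend zero_le_one v x := by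
  have hu' := intervalIntegrable_IccExtend hu
  have hv' := intervalIntegrable_IccExtend hv
  set V : ℝ → ℝ := fun x => ∫ y in (0 : ℝ)..x, IccExtend zero_le_one v y
  have hVc : ContinuousOn V (uIcc 0 1) :=
    (hv'.absolutelyContinuousOnInterval_intervalIntegral left_mem_uIcc).continuousOn
  have hext : ∀ (g : ℝ → ℝ) (w : I → ℝ),
      ∫ x in (0 : ℝ)..1, g x * IccExtend zero_le_one w x = ∫ t : I, g t * w t := fun g w => by
    simp only [← integral_unitInterval_eq_intervalIntegral, IccExtend_val]
  obtain ⟨c, hc⟩ := exists_ae_eq_const_of_integral_deriv_mul_eq_zero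
    (w := fun x => IccExtend zero_le_one u x - V x) zero_lt_one
    (hu'.sub hVc.intervalIntegrable) fun g hg hgc hgs => by
      have hg' : ContinuousOn (deriv g) (uIcc 0 1) :=
        (hg.continuous_deriv (by simp)).continuousOn
      have hg1 : g 1 = 0 := image_eq_zero_of_notMem_tsupport fun hmem => (hgs hmem).2.ne rfl
      simp only [mul_sub]
      rw [intervalIntegral.integral_sub (hu'.continuousOn_mul hg')
        (hg'.fun_mul hVc).intervalIntegrable, hext, h.2.2 g hg hgc hgs,
        integral_deriv_mul_intervalIntegral_eq_neg hv' (hg.of_le (by simp)) hg1, hext, sub_self]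
  refine ⟨c, (ae_unitInterval_of_ae_Ioo hc).mono fun t ht => ?_⟩
  rw [IccExtend_val] at ht
  exact sub_eq_iff_eq_add.1 ht

theorem exists_boundedContinuous_integral_sub_mul_sq_le {α : Type*} [TopologicalSpace α]
    [TopologicalSpace.PseudoMetrizableSpace α] [MeasurableSpace α] [BorelSpace α] {μ : Measure α}
    {v s : α → ℝ} (hv : MemLp v 2 μ) (hs : Measurable s) (hs2 : Integrable (fun x => s x ^ 2) μ)
    (h0 : ∀ᵐ x ∂μ, s x ≠ 0) {ε : ℝ} (hε : 0 < ε) :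
    ∃ r : BoundedContinuousFunction α ℝ, ∫ x, (v x - s x * r x) ^ 2 ∂μ ≤ ε := by
  -- Approximate `v / s` in `L²(s² μ)`.
  have hden : Measurable fun x => ENNReal.ofReal (s x ^ 2) := (hs.pow_const 2).ennreal_ofReal
  have hfin : ∀ᵐ x ∂μ, ENNReal.ofReal (s x ^ 2) < (∞ : ℝ≥0∞) :=
    .of_forall fun _ => ENNReal.ofReal_lt_top
  set ν := μ.withDensity fun x => ENNReal.ofReal (s x ^ 2)
  have : IsFiniteMeasure ν := isFiniteMeasure_withDensity_ofReal hs2.2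
  have hw : MemLp (fun x => v x / s x) 2 ν := by
    refine (memLp_two_iff_integrable_sq
      ((hv.1.aemeasurable.mono_ac (withDensity_absolutelyContinuous _ _)).div
        hs.aemeasurable).aestronglyMeasurable).2 ?_
    refine (integrable_withDensity_iff_integrable_smul' hden hfin).2 (hv.integrable_sq.congr ?_)
    filter_upwards [h0] with x hx
    rw [ENNReal.toReal_ofReal (sq_nonneg _), smul_eq_mul, Pi.div_apply]
    field_simp
  obtain ⟨r, hr, -⟩ := MemLp.exists_boundedContinuous_integral_rpow_sub_le (p := 2) two_pos
    (by simpa using hw) hε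
  refine ⟨r, le_of_eq_of_le ?_ hr⟩
  rw [integral_withDensity_eq_integral_toReal_smul hden hfin]
  refine integral_congr_ae ?_
  filter_upwards [h0] with x hx
  rw [ENNReal.toReal_ofReal (sq_nonneg _), smul_eq_mul, rpow_two, norm_eq_abs, sq_abs]
  field_simp

theorem exists_cosEval_near (r : C(I, ℝ)) {ε : ℝ} (hε : 0 < ε) :
    ∃ Q : ℝ[X], ∀ t : I, |r t - cosEval Q t| ≤ ε := by
  obtain ⟨Q, hQ⟩ := exists_polynomial_near_of_continuousOn (-1) 1
    (fun y => r (projIcc 0 1 zero_le_one (arccos y / π)))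
    (r.continuous.comp (continuous_projIcc.comp
      (continuous_arccos.div_const _))).continuousOn ε hε
  refine ⟨Q, fun t => ?_⟩
  have h := hQ (cos (π * t)) ⟨neg_one_le_cos _, cos_le_one _⟩
  rw [arccos_cos (mul_nonneg pi_pos.le t.2.1) (mul_le_of_le_one_right pi_pos.le t.2.2),
    mul_div_cancel_left₀ _ pi_ne_zero, projIcc_val] at h
  rw [abs_sub_comm]
  exact h.le

theorem memLp_unitInterval_of_continuous {F : I → ℝ} (hF : Continuous F) (p : ℝ≥0∞) :
    MemLp F p :=
  hF.memLp_of_hasCompactSupport (.of_compactSpace F)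

theorem exists_integral_sub_sin_mul_cosEval_sq_le {v : I → ℝ} (hv : MemLp v 2) {ε : ℝ}
    (hε : 0 < ε) : ∃ Q : ℝ[X], ∫ t : I, (v t - sin (π * t) * cosEval Q t) ^ 2 ≤ ε := by
  have hsin : Continuous fun t : I => sin (π * t) := by fun_prop
  have hne : ∀ᵐ t : I, sin (π * t) ≠ 0 := ae_unitInterval_of_ae_Ioo (.of_forall fun t ht =>
    (sin_pos_of_pos_of_lt_pi (mul_pos pi_pos ht.1) (mul_lt_of_lt_one_right pi_pos ht.2)).ne')
  obtain ⟨r, hr⟩ := exists_boundedContinuous_integral_sub_mul_sq_le hv hsin.measurable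
    (integrable_unitInterval_of_continuous (hsin.pow 2)) hne (show 0 < ε / 4 by positivity)
  obtain ⟨Q, hQ⟩ := exists_cosEval_near r.toContinuousMap (show 0 < √ε / 2 by positivity)
  have hcQ : Continuous fun t : I => cosEval Q t :=
    (continuous_cosEval Q).comp continuous_subtype_val
  have hint : ∀ {F : I → ℝ}, Continuous F → Integrable fun t => (v t - sin (π * t) * F t) ^ 2 :=
    fun hF => (hv.sub (memLp_unitInterval_of_continuous (hsin.mul hF) 2)).integrable_sq
  refine ⟨Q, ?_⟩
  calc ∫ t : I, (v t - sin (π * t) * cosEval Q t) ^ 2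
      ≤ ∫ t : I, (2 * (v t - sin (π * t) * r t) ^ 2 + ε / 2) := by
        refine integral_mono (hint hcQ)
          (((hint r.continuous).const_mul 2).add (integrable_const _)) fun t => ?_
        have hs : sin (π * t) ^ 2 ≤ 1 := sin_sq_le_one _
        have hrQ : (r t - cosEval Q t) ^ 2 ≤ ε / 4 := by
          calc (r t - cosEval Q t) ^ 2 ≤ (√ε / 2) ^ 2 :=
                sq_le_sq' (abs_le.1 (hQ t)).1 (abs_le.1 (hQ t)).2
            _ = ε / 4 := by rw [div_pow, sq_sqrt hε.le]; norm_num
        have hsplit : v t - sin (π * t) * cosEval Q t =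
            (v t - sin (π * t) * r t) + sin (π * t) * (r t - cosEval Q t) := by ring
        calc (v t - sin (π * t) * cosEval Q t) ^ 2
            ≤ 2 * ((v t - sin (π * t) * r t) ^ 2 + (sin (π * t) * (r t - cosEval Q t)) ^ 2) :=
              hsplit ▸ add_sq_le
          _ ≤ 2 * (v t - sin (π * t) * r t) ^ 2 + ε / 2 := by
              rw [mul_pow]
              nlinarith [mul_le_of_le_one_left (sq_nonneg (r t - cosEval Q t)) hs]
    _ = 2 * (∫ t : I, (v t - sin (π * t) * r t) ^ 2) + ε / 2 := by
        rw [integral_add ((hint r.continuous).const_mul 2) (integrable_const _),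
          integral_const_mul]
        simp
    _ ≤ ε := by linarith

theorem exists_polynomial_derivative_eq {K : Type*} [Field K] [CharZero K] (Q : K[X]) :
    ∃ P : K[X], derivative P = Q := by
  induction Q using Polynomial.induction_on' with
  | add P Q hP hQ =>
    obtain ⟨P', rfl⟩ := hP
    obtain ⟨Q', rfl⟩ := hQ
    exact ⟨P' + Q', derivative_add⟩
  | monomial n a =>
    refine ⟨monomial (n + 1) (a / (n + 1)), ?_⟩
    rw [derivative_monomial, Nat.cast_add_one, div_mul_cancel₀ a n.cast_add_one_ne_zero,
      Nat.add_sub_cancel]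

theorem exists_cosEvalDeriv_eq_sin_mul_cosEval (Q : ℝ[X]) (c : ℝ) :
    ∃ P, cosEval P 0 = c ∧ ∀ x, cosEvalDeriv P x = sin (π * x) * cosEval Q x := by
  obtain ⟨P, hP⟩ := exists_polynomial_derivative_eq (-(C π⁻¹ * Q))
  refine ⟨P + C (c - P.eval 1), by simp [cosEval], fun x => ?_⟩
  simp [cosEvalDeriv, cosEval, hP, pi_ne_zero]

theorem cosEval_eq_add_intervalIntegral (P : ℝ[X]) (x : ℝ) :
    cosEval P x = cosEval P 0 + ∫ y in (0 : ℝ)..x, cosEvalDeriv P y := by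
  rw [intervalIntegral.integral_eq_sub_of_hasDerivAt (f := cosEval P) (f' := cosEvalDeriv P)
    (fun y _ => hasDerivAt_cosEval P y) ((continuous_cosEvalDeriv P).intervalIntegrable _ _)]
  ring

theorem sq_integral_le_integral_sq {α : Type*} [MeasurableSpace α] {μ : Measure α}
    [IsProbabilityMeasure μ] {w : α → ℝ} (hw : MemLp w 2 μ) :
    (∫ x, w x ∂μ) ^ 2 ≤ ∫ x, w x ^ 2 ∂μ := by
  have := variance_nonneg w μ
  rw [variance_eq_sub hw] at this
  exact sub_nonneg.1 this

theorem sq_intervalIntegral_IccExtend_le {w : I → ℝ} (hw : MemLp w 2) (t : I) :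
    (∫ x in (0 : ℝ)..t, IccExtend zero_le_one w x) ^ 2 ≤ ∫ s, w s ^ 2 := by
  have hi := (intervalIntegrable_IccExtend (hw.integrable one_le_two)).abs
  have habs : |∫ x in (0 : ℝ)..t, IccExtend zero_le_one w x| ≤ ∫ s, |w s| :=
    calc |∫ x in (0 : ℝ)..t, IccExtend zero_le_one w x|
        ≤ ∫ x in (0 : ℝ)..t, |IccExtend zero_le_one w x| :=
          intervalIntegral.abs_integral_le_integral_abs t.2.1
      _ ≤ ∫ x in (0 : ℝ)..1, |IccExtend zero_le_one w x| :=
          intervalIntegral.integral_mono_interval le_rfl t.2.1 t.2.2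
            (.of_forall fun _ => abs_nonneg _) hi
      _ = ∫ s, |w s| := by
          simp only [← integral_unitInterval_eq_intervalIntegral, IccExtend_val]
  calc (∫ x in (0 : ℝ)..t, IccExtend zero_le_one w x) ^ 2
      ≤ (∫ s, |w s|) ^ 2 := sq_le_sq' (abs_le.1 habs).1 (abs_le.1 habs).2
    _ ≤ ∫ s, |w s| ^ 2 := sq_integral_le_integral_sq hw.abs
    _ = ∫ s, w s ^ 2 := by simp only [sq_abs]

theorem HasWeakDerivUnit.exists_cosEval_near {u v : I → ℝ} (hu : MemLp u 2) (hv : MemLp v 2)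
    (h : HasWeakDerivUnit u v) {ε : ℝ} (hε : 0 < ε) :
    ∃ P : ℝ[X], ∫ t : I, (u t - cosEval P t) ^ 2 ≤ ε ∧
      ∫ t : I, (v t - cosEvalDeriv P t) ^ 2 ≤ ε := by
  obtain ⟨c, hc⟩ := h.exists_ae_eq_add_integral (hu.integrable one_le_two)
    (hv.integrable one_le_two)
  obtain ⟨Q, hQ⟩ := exists_integral_sub_sin_mul_cosEval_sq_le hv hε
  obtain ⟨P, hP0, hP⟩ := exists_cosEvalDeriv_eq_sin_mul_cosEval Q c
  simp only [← hP] at hQ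
  have hcont : Continuous fun t : I => cosEvalDeriv P t :=
    (continuous_cosEvalDeriv P).comp continuous_subtype_val
  have hw : MemLp (fun t : I => v t - cosEvalDeriv P t) 2 :=
    hv.sub (memLp_unitInterval_of_continuous hcont 2)
  have hbound : ∀ᵐ t : I, (u t - cosEval P t) ^ 2 ≤ ε := by
    filter_upwards [hc] with t ht
    have hdiff : u t - cosEval P t = ∫ x in (0 : ℝ)..t,
        IccExtend zero_le_one (fun s : I => v s - cosEvalDeriv P s) x := by
      have hsub : ∀ x ∈ uIcc (0 : ℝ) t,
          IccExtend zero_le_one (fun s : I => v s - cosEvalDeriv P s) x =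
            IccExtend zero_le_one v x - cosEvalDeriv P x := fun x hx => by
        rw [uIcc_of_le t.2.1] at hx
        simp only [IccExtend_of_mem _ _ (⟨hx.1, hx.2.trans t.2.2⟩ : x ∈ Icc (0 : ℝ) 1)]
      rw [intervalIntegral.integral_congr hsub, intervalIntegral.integral_sub
        ((intervalIntegrable_IccExtend (hv.integrable one_le_two)).mono_set (by
          rw [uIcc_of_le t.2.1, uIcc_of_le zero_le_one]; exact Icc_subset_Icc_right t.2.2))
        ((continuous_cosEvalDeriv P).intervalIntegrable _ _), ht,
        cosEval_eq_add_intervalIntegral P t, hP0]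
      ring
    exact hdiff ▸ (sq_intervalIntegral_IccExtend_le hw t).trans hQ
  refine ⟨P, ?_, hQ⟩
  calc ∫ t : I, (u t - cosEval P t) ^ 2 ≤ ∫ _ : I, ε :=
        integral_mono_of_nonneg (.of_forall fun t => sq_nonneg _) (integrable_const _) hbound
    _ = ε := by simp

theorem integral_abs_mul_le_sqrt_mul_sqrt {α : Type*} [MeasurableSpace α] {μ : Measure α}
    {f g : α → ℝ} (hf : MemLp f 2 μ) (hg : MemLp g 2 μ) :
    ∫ x, |f x * g x| ∂μ ≤ √(∫ x, f x ^ 2 ∂μ) * √(∫ x, g x ^ 2 ∂μ) := by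
  have h := integral_mul_norm_le_Lp_mul_Lq HolderConjugate.two_two
    (show MemLp f (ENNReal.ofReal 2) μ by simpa using hf)
    (show MemLp g (ENNReal.ofReal 2) μ by simpa using hg)
  simpa only [norm_eq_abs, rpow_two, sq_abs, ← sqrt_eq_rpow, abs_mul] using h

theorem tendsto_integral_sq_mul {α ι : Type*} [MeasurableSpace α] {μ : Measure α} {l : Filter ι}
    {u h : α → ℝ} {p : ι → α → ℝ} {B : ℝ} (hu : MemLp u 2 μ) (hp : ∀ i, MemLp (p i) 2 μ)
    (hlim : Tendsto (fun i => ∫ x, (u x - p i x) ^ 2 ∂μ) l (𝓝 0))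
    (hm : AEStronglyMeasurable h μ) (hb : ∀ x, |h x| ≤ B) :
    Tendsto (fun i => ∫ x, p i x ^ 2 * h x ∂μ) l (𝓝 (∫ x, u x ^ 2 * h x ∂μ)) := by
  have hmul : ∀ {F : α → ℝ}, MemLp F 2 μ → Integrable (fun x => F x ^ 2 * h x) μ := fun hF =>
    hF.integrable_sq.mul_bdd hm (.of_forall hb)
  have hpt : ∀ i x, |p i x ^ 2 * h x - u x ^ 2 * h x| ≤
      B * ((u x - p i x) ^ 2 + 2 * |u x * (u x - p i x)|) := fun i x => by
    have hsq : |p i x ^ 2 - u x ^ 2| ≤ (u x - p i x) ^ 2 + 2 * |u x * (u x - p i x)| := by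
      calc |p i x ^ 2 - u x ^ 2| = |(u x - p i x) ^ 2 - 2 * (u x * (u x - p i x))| := by
            congr 1; ring
        _ ≤ |(u x - p i x) ^ 2| + |2 * (u x * (u x - p i x))| := abs_sub _ _
        _ = (u x - p i x) ^ 2 + 2 * |u x * (u x - p i x)| := by
            rw [abs_of_nonneg (sq_nonneg _), abs_mul, abs_two]
    rw [← sub_mul, abs_mul, mul_comm]
    exact mul_le_mul (hb x) hsq (abs_nonneg _) ((abs_nonneg _).trans (hb x))
  have hdist : ∀ i, |∫ x, p i x ^ 2 * h x ∂μ - ∫ x, u x ^ 2 * h x ∂μ| ≤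
      |B| * (∫ x, (u x - p i x) ^ 2 ∂μ +
        2 * (√(∫ x, u x ^ 2 ∂μ) * √(∫ x, (u x - p i x) ^ 2 ∂μ))) := fun i => by
    have hd : MemLp (fun x => u x - p i x) 2 μ := hu.sub (hp i)
    have hi : Integrable (fun x => 2 * |u x * (u x - p i x)|) μ :=
      (hu.integrable_mul hd).abs.const_mul 2
    rw [← integral_sub (hmul (hp i)) (hmul hu)]
    refine (abs_integral_le_integral_abs).trans ((integral_mono ((hmul (hp i)).sub (hmul hu)).abs
      ((hd.integrable_sq.add hi).const_mul B) (hpt i)).trans ?_)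
    rw [integral_const_mul, integral_add' hd.integrable_sq hi, integral_const_mul]
    have hcs := integral_abs_mul_le_sqrt_mul_sqrt hu hd
    exact mul_le_mul (le_abs_self B) (by gcongr) (add_nonneg (integral_nonneg fun x => sq_nonneg _)
      (mul_nonneg zero_le_two (integral_nonneg fun x => abs_nonneg _))) (abs_nonneg B)
  refine tendsto_iff_norm_sub_tendsto_zero.2 (squeeze_zero (fun _ => norm_nonneg _) hdist ?_)
  simpa using (hlim.add (((continuous_sqrt.tendsto 0).comp hlim |>.const_mul
    √(∫ x, u x ^ 2 ∂μ)).const_mul 2)).const_mul |B|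

theorem HasWeakDerivUnit.integral_sq_mul_le {u v : I → ℝ} (huv : HasWeakDerivUnit u v)
    (hu : MemLp u 2) (hv : MemLp v 2) {h : I → ℝ} (hm : Measurable h) {B : ℝ}
    (hb : ∀ t, |h t| ≤ B) (hexp : ∫ t, exp (h t) ≤ 1) :
    ∫ t, u t ^ 2 * h t ≤ 2 / π ^ 2 * ∫ t, v t ^ 2 := by
  choose P hPu hPv using fun n : ℕ =>
    huv.exists_cosEval_near hu hv (Nat.one_div_pos_of_nat (α := ℝ) (n := n))
  have hlim : ∀ {w : I → ℝ} {p : ℕ → I → ℝ}, (∀ n, ∫ t, (w t - p n t) ^ 2 ≤ 1 / ((n : ℝ) + 1)) →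
      Tendsto (fun n => ∫ t, (w t - p n t) ^ 2) atTop (𝓝 0) := fun hp =>
    squeeze_zero (fun _ => integral_nonneg fun _ => sq_nonneg _) hp
      tendsto_one_div_add_atTop_nhds_zero_nat
  have hmem : ∀ {F : ℝ → ℝ}, Continuous F → MemLp (fun t : I => F t) 2 := fun hF =>
    memLp_unitInterval_of_continuous (hF.comp continuous_subtype_val) 2
  have hleft := tendsto_integral_sq_mul hu (fun n => hmem (continuous_cosEval (P n))) (hlim hPu)
    hm.aestronglyMeasurable hb
  have hright := tendsto_integral_sq_mul (h := 1) (B := 1) hv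
    (fun n => hmem (continuous_cosEvalDeriv (P n))) (hlim hPv) aestronglyMeasurable_one (by simp)
  simp only [Pi.one_apply, mul_one] at hright
  exact le_of_tendsto_of_tendsto' hleft (hright.const_mul _) fun n =>
    integral_cosEval_sq_mul_le (P n) hm hb hexp

end WeakDerivative

section CoordinateAverage

open Filter Function Topology

variable {ι : Type*} [DecidableEq ι] {X : ι → Type*}

theorem update_insert_piecewise {s : Finset ι} {i : ι} (hi : i ∉ s) (x y : ∀ j, X j) (t : X i) :
    update ((insert i s).piecewise x y) i t = s.piecewise x (update y i t) := by
  rw [s.piecewise_insert, update_idem, s.update_piecewise_of_notMem _ _ hi]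

theorem update_piecewise_eq_erase_piecewise {s : Finset ι} {i : ι} (hi : i ∈ s) (x y : ∀ j, X j)
    (t : X i) :
    update (s.piecewise x y) i t = (s.erase i).piecewise x (update y i t) := by
  conv_lhs => rw [← Finset.insert_erase hi]
  exact update_insert_piecewise (s.notMem_erase i) x y t

variable [∀ i, MeasurableSpace (X i)]

theorem measurable_finsetPiecewise (s : Finset ι) :
    Measurable fun z : (∀ i, X i) × (∀ i, X i) => s.piecewise z.1 z.2 := by
  refine measurable_pi_lambda _ fun i => ?_
  by_cases hi : i ∈ s
  · simp only [s.piecewise_eq_of_mem _ _ hi]; fun_prop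
  · simp only [s.piecewise_eq_of_notMem _ _ hi]; fun_prop

variable (μ : ∀ i, Measure (X i))

/-- The average of `f` over all coordinates outside `s`, the coordinates in `s` being frozen at
those of `x`: the conditional expectation of `f` given the coordinates in `s`, as a genuine
function. -/
noncomputable def avgOutside (s : Finset ι) (f : (∀ i, X i) → ℝ) (x : ∀ i, X i) : ℝ :=
  ∫ y, f (s.piecewise x y) ∂Measure.infinitePi μ

theorem dependsOn_avgOutside (s : Finset ι) (f : (∀ i, X i) → ℝ) :
    DependsOn (avgOutside μ s f) s := fun x x' h => by
  have hpw : ∀ y, s.piecewise x y = s.piecewise x' y := fun y =>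
    s.piecewise_congr h fun _ _ => rfl
  simp only [avgOutside, hpw]

theorem avgOutside_empty (f : (∀ i, X i) → ℝ) (x : ∀ i, X i) :
    avgOutside μ ∅ f x = ∫ y, f y ∂Measure.infinitePi μ := by
  simp only [avgOutside, Finset.piecewise_empty]

theorem avgOutside_update {s : Finset ι} {i : ι} (hi : i ∉ s) (f : (∀ j, X j) → ℝ) (x : ∀ j, X j)
    (t : X i) : avgOutside μ s f (update x i t) = avgOutside μ s f x :=
  dependsOn_avgOutside μ s f fun _ hj => update_of_ne (ne_of_mem_of_not_mem hj hi) t x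

variable [∀ i, IsProbabilityMeasure (μ i)]

theorem measurePreserving_finsetPiecewise (s : Finset ι) :
    MeasurePreserving (fun z : (∀ i, X i) × (∀ i, X i) => s.piecewise z.1 z.2)
      ((Measure.infinitePi μ).prod (Measure.infinitePi μ)) (Measure.infinitePi μ) := by
  refine ⟨measurable_finsetPiecewise s, Measure.eq_infinitePi μ fun S T hT => ?_⟩
  have hpre : (fun z : (∀ i, X i) × (∀ i, X i) => s.piecewise z.1 z.2) ⁻¹' (S : Set ι).pi T =
      ((S.filter (· ∈ s) : Finset ι) : Set ι).pi T ×ˢ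
        ((S.filter (· ∉ s) : Finset ι) : Set ι).pi T := by
    ext ⟨x, y⟩
    simp only [mem_preimage, Set.mem_pi, mem_prod, Finset.mem_coe, Finset.mem_filter,
      Finset.piecewise]
    grind
  rw [Measure.map_apply (measurable_finsetPiecewise s)
      (.pi S.countable_toSet fun i _ => hT i), hpre, Measure.prod_prod,
    Measure.infinitePi_pi μ fun i _ => hT i, Measure.infinitePi_pi μ fun i _ => hT i,
    Finset.prod_filter_mul_prod_filter_not]

theorem measurePreserving_update (i : ι) :
    MeasurePreserving (fun z : (∀ j, X j) × X i => update z.1 i z.2)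
      ((Measure.infinitePi μ).prod (μ i)) (Measure.infinitePi μ) := by
  have heval := (MeasurePreserving.id (Measure.infinitePi μ)).prod
    (measurePreserving_eval_infinitePi μ i)
  have hswap := (measurePreserving_finsetPiecewise μ {i}).comp Measure.measurePreserving_swap
  refine ⟨measurable_update', ?_⟩
  have hcomp : (fun z : (∀ j, X j) × X i => update z.1 i z.2) ∘ Prod.map id (eval i) =
      (fun z : (∀ j, X j) × (∀ j, X j) => Finset.piecewise {i} z.1 z.2) ∘ Prod.swap := by
    ext1 z
    simp [Finset.piecewise_singleton]
  rw [← heval.map_eq, Measure.map_map measurable_update' heval.measurable, hcomp, hswap.map_eq]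

section Slices

variable {μ} {f : (∀ i, X i) → ℝ} (hf : Integrable f (Measure.infinitePi μ))
include hf

theorem integrable_comp_update (i : ι) :
    Integrable (fun z : (∀ j, X j) × X i => f (update z.1 i z.2))
      ((Measure.infinitePi μ).prod (μ i)) :=
  (measurePreserving_update μ i).integrable_comp_of_integrable hf

theorem integrable_comp_finsetPiecewise (s : Finset ι) :
    Integrable (fun z : (∀ i, X i) × (∀ i, X i) => f (s.piecewise z.1 z.2))
      ((Measure.infinitePi μ).prod (Measure.infinitePi μ)) :=
  (measurePreserving_finsetPiecewise μ s).integrable_comp_of_integrable hf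

theorem integrable_update_ae (i : ι) :
    ∀ᵐ x ∂Measure.infinitePi μ, Integrable (fun t => f (update x i t)) (μ i) :=
  (integrable_comp_update hf i).prod_right_ae

theorem integrable_finsetPiecewise_ae (s : Finset ι) :
    ∀ᵐ x ∂Measure.infinitePi μ, Integrable (fun y => f (s.piecewise x y)) (Measure.infinitePi μ) :=
  (integrable_comp_finsetPiecewise hf s).prod_right_ae

theorem integrable_integral_update (i : ι) :
    Integrable (fun x => ∫ t, f (update x i t) ∂μ i) (Measure.infinitePi μ) :=
  (integrable_comp_update hf i).integral_prod_left

theorem integrable_avgOutside (s : Finset ι) :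
    Integrable (avgOutside μ s f) (Measure.infinitePi μ) :=
  (integrable_comp_finsetPiecewise hf s).integral_prod_left

theorem integral_integral_update (i : ι) :
    ∫ x, ∫ t, f (update x i t) ∂μ i ∂Measure.infinitePi μ = ∫ x, f x ∂Measure.infinitePi μ := by
  have hmp := measurePreserving_update μ i
  rw [← integral_prod _ (integrable_comp_update hf i), ← integral_map hmp.aemeasurable
    (hmp.map_eq.symm ▸ hf.1), hmp.map_eq]

theorem integral_avgOutside (s : Finset ι) :
    ∫ x, avgOutside μ s f x ∂Measure.infinitePi μ = ∫ x, f x ∂Measure.infinitePi μ := by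
  have hmp := measurePreserving_finsetPiecewise μ s
  simp only [avgOutside]
  rw [← integral_prod _ (integrable_comp_finsetPiecewise hf s), ← integral_map hmp.aemeasurable
    (hmp.map_eq.symm ▸ hf.1), hmp.map_eq]

end Slices

variable {μ} {f g : (∀ i, X i) → ℝ} {s : Finset ι}

theorem memLp_update_ae (hf : MemLp f 2 (Measure.infinitePi μ)) (i : ι) :
    ∀ᵐ x ∂Measure.infinitePi μ, MemLp (fun t => f (update x i t)) 2 (μ i) := by
  filter_upwards [integrable_update_ae hf.integrable_sq i,
    (hf.1.comp_measurePreserving (measurePreserving_update μ i)).prodMk_left] with x hsq hm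
  exact (memLp_two_iff_integrable_sq hm).2 hsq

theorem memLp_finsetPiecewise_ae (hf : MemLp f 2 (Measure.infinitePi μ)) (s : Finset ι) :
    ∀ᵐ x ∂Measure.infinitePi μ, MemLp (fun y => f (s.piecewise x y)) 2 (Measure.infinitePi μ) := by
  filter_upwards [integrable_finsetPiecewise_ae hf.integrable_sq s,
    (hf.1.comp_measurePreserving (measurePreserving_finsetPiecewise μ s)).prodMk_left]
    with x hsq hm
  exact (memLp_two_iff_integrable_sq hm).2 hsq

theorem avgOutside_of_dependsOn (hg : DependsOn g s) : avgOutside μ s g = g := by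
  ext x
  have hpw : ∀ y, g (s.piecewise x y) = g x := fun y => hg fun i hi => s.piecewise_eq_of_mem _ _ hi
  simp only [avgOutside, hpw, integral_const, probReal_univ, one_smul]

theorem measurable_avgOutside (hf : Measurable f) (s : Finset ι) :
    Measurable[Filtration.piFinset s] (avgOutside μ s f) := by
  have hjoint : StronglyMeasurable fun z : (∀ i : s, X i) × (∀ i, X i) =>
      f (updateFinset z.2 s z.1) :=
    (hf.comp (measurable_updateFinset'.comp measurable_swap)).stronglyMeasurable
  have hfactor : avgOutside μ s f =
      (fun z => ∫ y, f (updateFinset y s z) ∂Measure.infinitePi μ) ∘ s.restrict := by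
    ext x
    have hpw : ∀ y, s.piecewise x y = updateFinset y s (s.restrict x) := fun y => by
      ext i; simp [Finset.piecewise, updateFinset]
    simp only [avgOutside, hpw, comp_apply]
  rw [hfactor]
  exact hjoint.integral_prod_right'.measurable.comp (comap_measurable _)

theorem integral_avgOutside_mul (hg : DependsOn g s)
    (hfg : Integrable (fun x => f x * g x) (Measure.infinitePi μ)) :
    ∫ x, avgOutside μ s f x * g x ∂Measure.infinitePi μ =
      ∫ x, f x * g x ∂Measure.infinitePi μ := by
  have hpw : ∀ x y, g (s.piecewise x y) = g x := fun x y =>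
    hg fun i hi => s.piecewise_eq_of_mem _ _ hi
  rw [← integral_avgOutside hfg s]
  simp only [avgOutside, hpw, integral_mul_const]

theorem avgOutside_ae_eq_condExp (hf : Measurable f) (hfi : Integrable f (Measure.infinitePi μ))
    (s : Finset ι) :
    avgOutside μ s f =ᵐ[Measure.infinitePi μ]
      (Measure.infinitePi μ)[f | Filtration.piFinset s] := by
  refine ae_eq_condExp_of_forall_setIntegral_eq (Filtration.piFinset.le s) hfi
    (fun A _ _ => (integrable_avgOutside hfi s).integrableOn) (fun A hA _ => ?_)
    (measurable_avgOutside hf s).stronglyMeasurable.aestronglyMeasurable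
  have hA' := Filtration.piFinset.le s A hA
  have hdep : DependsOn (A.indicator fun _ => (1 : ℝ)) s :=
    Measurable.dependsOn_of_piFinset (measurable_const.indicator hA)
  have hmul : ∀ F : (∀ i, X i) → ℝ, A.indicator F = fun x => F x * A.indicator (fun _ => 1) x :=
    fun F => by ext x; by_cases hx : x ∈ A <;> simp [hx]
  rw [← integral_indicator hA', ← integral_indicator hA', hmul, hmul f]
  exact integral_avgOutside_mul hdep (hmul f ▸ hfi.indicator hA')

section Insert

variable {i : ι} (hi : i ∉ s)
include hi

theorem integral_avgOutside_insert_update {x : ∀ j, X j}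
    (hx : Integrable (fun y => f (s.piecewise x y)) (Measure.infinitePi μ)) :
    ∫ t, avgOutside μ (insert i s) f (update x i t) ∂μ i = avgOutside μ s f x := by
  have hpw : ∀ y t, (insert i s).piecewise (update x i t) y = s.piecewise x (update y i t) :=
    fun y t => by
      rw [← update_insert_piecewise hi, Finset.update_piecewise_of_mem _ _ _
        (Finset.mem_insert_self i s)]
  simp only [avgOutside, hpw]
  rw [← integral_integral_swap (integrable_comp_update hx i), integral_integral_update hx]

theorem avgOutside_insert_integral_update {x : ∀ j, X j}
    (hx : Integrable (fun y => f (s.piecewise x y)) (Measure.infinitePi μ)) :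
    avgOutside μ (insert i s) (fun y => ∫ t, f (update y i t) ∂μ i) x = avgOutside μ s f x := by
  simp only [avgOutside, update_insert_piecewise hi]
  exact integral_integral_update hx i

/-- The difference of the two averages is the average over the coordinates outside `insert i s` of
the deviation of `f` from its mean in the `i`-th coordinate. -/
theorem integral_abs_avgOutside_insert_sub_le (hf : Integrable f (Measure.infinitePi μ)) :
    ∫ x, |avgOutside μ (insert i s) f x - avgOutside μ s f x| ∂Measure.infinitePi μ ≤
      ∫ x, |f x - ∫ t, f (update x i t) ∂μ i| ∂Measure.infinitePi μ := by
  have hmean := integrable_integral_update hf i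
  have hdev : Integrable (fun x => f x - ∫ t, f (update x i t) ∂μ i) (Measure.infinitePi μ) :=
    hf.sub hmean
  rw [← integral_avgOutside hdev.abs (insert i s)]
  refine integral_mono_ae ((integrable_avgOutside hf _).sub (integrable_avgOutside hf _)).abs
    (integrable_avgOutside hdev.abs _) ?_
  filter_upwards [integrable_finsetPiecewise_ae hf s,
    integrable_finsetPiecewise_ae hf (insert i s),
    integrable_finsetPiecewise_ae hmean (insert i s)] with x hs hins hmean'
  rw [← avgOutside_insert_integral_update hi hs]
  simp only [avgOutside]
  rw [← integral_sub hins hmean']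
  exact abs_integral_le_integral_abs

end Insert

theorem memLp_avgOutside (hf : MemLp f 2 (Measure.infinitePi μ)) (s : Finset ι) :
    MemLp (avgOutside μ s f) 2 (Measure.infinitePi μ) := by
  have hm := (integrable_avgOutside (hf.integrable one_le_two) s).1
  refine (memLp_two_iff_integrable_sq hm).2
    ((integrable_avgOutside hf.integrable_sq s).mono' (hm.pow 2) ?_)
  filter_upwards [memLp_finsetPiecewise_ae hf s] with x hx
  rw [Real.norm_eq_abs, abs_of_nonneg (sq_nonneg _)]
  exact sq_integral_le_integral_sq hx

theorem integral_sq_avgOutside_sub {t : Finset ι} (hst : s ⊆ t)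
    (hf : MemLp f 2 (Measure.infinitePi μ)) :
    ∫ x, (avgOutside μ t f x - avgOutside μ s f x) ^ 2 ∂Measure.infinitePi μ =
      ∫ x, avgOutside μ t f x ^ 2 ∂Measure.infinitePi μ -
        ∫ x, avgOutside μ s f x ^ 2 ∂Measure.infinitePi μ := by
  have hs := memLp_avgOutside hf s
  have ht := memLp_avgOutside hf t
  have hcross : ∫ x, avgOutside μ t f x * avgOutside μ s f x ∂Measure.infinitePi μ =
      ∫ x, avgOutside μ s f x ^ 2 ∂Measure.infinitePi μ := by
    rw [integral_avgOutside_mul ((dependsOn_avgOutside μ s f).mono (Finset.coe_subset.2 hst))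
      (hf.integrable_mul hs), ← integral_avgOutside_mul (dependsOn_avgOutside μ s f)
      (hf.integrable_mul hs)]
    simp only [sq]
  have hexpand : ∀ x, (avgOutside μ t f x - avgOutside μ s f x) ^ 2 = avgOutside μ t f x ^ 2 -
      2 * (avgOutside μ t f x * avgOutside μ s f x) + avgOutside μ s f x ^ 2 := fun x => by ring
  have hi : Integrable (fun x => 2 * (avgOutside μ t f x * avgOutside μ s f x))
      (Measure.infinitePi μ) := (ht.integrable_mul hs).const_mul 2
  simp only [hexpand]
  rw [integral_add (by exact ht.integrable_sq.sub hi) hs.integrable_sq,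
    integral_sub ht.integrable_sq hi, integral_const_mul, hcross]
  ring

theorem integral_sq_avgOutside_le (hf : MemLp f 2 (Measure.infinitePi μ)) (s : Finset ι) :
    ∫ x, avgOutside μ s f x ^ 2 ∂Measure.infinitePi μ ≤ ∫ x, f x ^ 2 ∂Measure.infinitePi μ := by
  rw [← integral_avgOutside hf.integrable_sq s]
  refine integral_mono_ae (memLp_avgOutside hf s).integrable_sq
    (integrable_avgOutside hf.integrable_sq s) ?_
  filter_upwards [memLp_finsetPiecewise_ae hf s] with x hx
  exact sq_integral_le_integral_sq hx

theorem tendsto_integral_sq_of_tendsto_ae {α : Type*} [MeasurableSpace α] {ν : Measure α}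
    {u : ℕ → α → ℝ} {v : α → ℝ} (hu : ∀ n, MemLp (u n) 2 ν) (hv : MemLp v 2 ν)
    (hle : ∀ n, ∫ x, u n x ^ 2 ∂ν ≤ ∫ x, v x ^ 2 ∂ν)
    (hlim : ∀ᵐ x ∂ν, Tendsto (fun n => u n x) atTop (𝓝 (v x))) :
    Tendsto (fun n => ∫ x, u n x ^ 2 ∂ν) atTop (𝓝 (∫ x, v x ^ 2 ∂ν)) := by
  have hofReal : ∀ {w : α → ℝ}, MemLp w 2 ν →
      ENNReal.ofReal (∫ x, w x ^ 2 ∂ν) = ∫⁻ x, ENNReal.ofReal (w x ^ 2) ∂ν := fun hw =>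
    ofReal_integral_eq_lintegral_ofReal hw.integrable_sq (.of_forall fun _ => sq_nonneg _)
  have hfatou : ENNReal.ofReal (∫ x, v x ^ 2 ∂ν) ≤
      liminf (fun n => ENNReal.ofReal (∫ x, u n x ^ 2 ∂ν)) atTop := by
    simp only [hofReal hv, hofReal (hu _)]
    refine (lintegral_mono_ae ?_).trans (lintegral_liminf_le' fun n =>
      ((hu n).1.aemeasurable.pow_const 2).ennreal_ofReal)
    filter_upwards [hlim] with x hx
    exact (ENNReal.tendsto_ofReal (hx.pow 2)).liminf_eq.ge
  have htend := tendsto_of_le_liminf_of_limsup_le hfatou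
    (limsup_le_of_le (h := .of_forall fun n => ENNReal.ofReal_le_ofReal (hle n)))
  have hnonneg : ∀ {w : α → ℝ}, 0 ≤ ∫ x, w x ^ 2 ∂ν := integral_nonneg fun _ => sq_nonneg _
  simpa only [comp_def, ENNReal.toReal_ofReal hnonneg] using
    (ENNReal.tendsto_toReal ENNReal.ofReal_ne_top).comp htend

theorem tendsto_avgOutside_ae {S : ℕ → Finset ι} (hS : Monotone S) (hcover : ∀ i, ∃ n, i ∈ S n)
    (hf : Measurable f) (hfi : Integrable f (Measure.infinitePi μ)) :
    ∀ᵐ x ∂Measure.infinitePi μ, Tendsto (fun n => avgOutside μ (S n) f x) atTop (𝓝 (f x)) := by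
  let ℱ : Filtration ℕ (MeasurableSpace.pi (X := X)) :=
    ⟨fun n => Filtration.piFinset (S n), fun _ _ h => Filtration.piFinset.mono (hS h),
      fun n => Filtration.piFinset.le (S n)⟩
  have hsup : MeasurableSpace.pi ≤ ⨆ n, ℱ n := iSup_le fun i => by
    obtain ⟨n, hn⟩ := hcover i
    refine le_iSup_of_le n (measurable_iff_comap_le.1 ?_)
    exact (measurable_pi_apply (⟨i, hn⟩ : S n)).comp (comap_measurable (S n).restrict)
  have hcond : ∀ᵐ x ∂Measure.infinitePi μ, ∀ n,
      avgOutside μ (S n) f x = ((Measure.infinitePi μ)[f | ℱ n]) x :=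
    ae_all_iff.2 fun n => avgOutside_ae_eq_condExp hf hfi (S n)
  filter_upwards [hcond, hfi.tendsto_ae_condExp (hf.mono hsup le_rfl).stronglyMeasurable]
    with x hx hlim
  simpa only [hx] using hlim

theorem tendsto_integral_sq_avgOutside {S : ℕ → Finset ι} (hS : Monotone S)
    (hcover : ∀ i, ∃ n, i ∈ S n) (hf : Measurable f) (hf2 : MemLp f 2 (Measure.infinitePi μ)) :
    Tendsto (fun n => ∫ x, avgOutside μ (S n) f x ^ 2 ∂Measure.infinitePi μ) atTop
      (𝓝 (∫ x, f x ^ 2 ∂Measure.infinitePi μ)) :=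
  tendsto_integral_sq_of_tendsto_ae (fun n => memLp_avgOutside hf2 (S n)) hf2
    (fun n => integral_sq_avgOutside_le hf2 (S n))
    (tendsto_avgOutside_ae hS hcover hf (hf2.integrable one_le_two))

theorem integrable_finsetPiecewise_of_mem_Icc {a b : ℝ} (hf : Measurable f)
    (hab : ∀ x, f x ∈ Icc a b) (s : Finset ι) (x : ∀ i, X i) :
    Integrable (fun y => f (s.piecewise x y)) (Measure.infinitePi μ) :=
  .of_mem_Icc a b
    (hf.comp ((measurable_finsetPiecewise s).comp measurable_prodMk_left)).aemeasurable
    (.of_forall fun _ => hab _)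

theorem avgOutside_mem_Icc {a b : ℝ} (hf : Measurable f) (hab : ∀ x, f x ∈ Icc a b) (s : Finset ι)
    (x : ∀ i, X i) : avgOutside μ s f x ∈ Icc a b :=
  (convex_Icc a b).integral_mem isClosed_Icc (.of_forall fun _ => hab _)
    (integrable_finsetPiecewise_of_mem_Icc hf hab s x)

/-- The witness is `H = log (avgOutside μ s (exp ∘ h))`. -/
theorem exists_dependsOn_integral_exp_sub_update_le_one {i : ι} (hi : i ∉ s) {h : (∀ i, X i) → ℝ}
    (hm : Measurable h) {C : ℝ} (hb : ∀ x, |h x| ≤ C)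
    (hdep : DependsOn h (insert i s : Finset ι))
    (hexp : ∫ x, Real.exp (h x) ∂Measure.infinitePi μ ≤ 1) :
    ∃ H : (∀ i, X i) → ℝ, Measurable H ∧ (∀ x, |H x| ≤ C) ∧ DependsOn H s ∧
      ∫ x, Real.exp (H x) ∂Measure.infinitePi μ ≤ 1 ∧
        ∀ x, ∫ t, Real.exp (h (update x i t) - H (update x i t)) ∂μ i ≤ 1 := by
  let E : (∀ i, X i) → ℝ := fun x => Real.exp (h x)
  have hmE : Measurable E := hm.exp
  have hE : ∀ x, E x ∈ Icc (Real.exp (-C)) (Real.exp C) := fun x =>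
    ⟨Real.exp_le_exp.2 (abs_le.1 (hb x)).1, Real.exp_le_exp.2 (abs_le.1 (hb x)).2⟩
  have havg := avgOutside_mem_Icc (μ := μ) hmE hE s
  have hpos : ∀ x, 0 < avgOutside μ s E x := fun x => (Real.exp_pos _).trans_le (havg x).1
  refine ⟨fun x => Real.log (avgOutside μ s E x),
    ((measurable_avgOutside hmE s).mono (Filtration.piFinset.le s) le_rfl).log, fun x =>
      abs_le.2 ⟨(Real.le_log_iff_exp_le (hpos x)).2 (havg x).1,
        (Real.log_le_iff_le_exp (hpos x)).2 (havg x).2⟩,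
    fun x y hxy => congrArg Real.log (dependsOn_avgOutside μ s E hxy), ?_, fun x => ?_⟩
  · simp only [Real.exp_log (hpos _)]
    rwa [integral_avgOutside (.of_mem_Icc _ _ hmE.aemeasurable (.of_forall hE))]
  · have hins : avgOutside μ (insert i s) E = E :=
      avgOutside_of_dependsOn fun x y hxy => congrArg Real.exp (hdep hxy)
    have hmean := integral_avgOutside_insert_update hi
      (integrable_finsetPiecewise_of_mem_Icc (μ := μ) hmE hE s x)
    rw [hins] at hmean
    simp only [Real.exp_sub, Real.exp_log (hpos _), avgOutside_update μ hi]
    rw [integral_div, hmean, div_self (hpos x).ne']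

/-- Tensorization of the dual form of an entropy bound: a function `h` with `∫ exp h ≤ 1` is the sum
of the increments of the logarithms of the successive averages of `exp h`, and each increment is
admissible in one coordinate. -/
theorem integral_mul_le_sum_of_forall_update {G : (∀ i, X i) → ℝ} {D : ι → ℝ}
    (hG : Integrable G (Measure.infinitePi μ)) (hG0 : ∀ x, 0 ≤ G x)
    (hD : ∀ i ∈ s, ∀ L : (∀ i, X i) → ℝ, Measurable L → ∀ C, (∀ x, |L x| ≤ C) →
      (∀ x, ∫ t, Real.exp (L (update x i t)) ∂μ i ≤ 1) →
        ∫ x, G x * L x ∂Measure.infinitePi μ ≤ D i)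
    {h : (∀ i, X i) → ℝ} (hm : Measurable h) {C : ℝ} (hb : ∀ x, |h x| ≤ C) (hdep : DependsOn h s)
    (hexp : ∫ x, Real.exp (h x) ∂Measure.infinitePi μ ≤ 1) :
    ∫ x, G x * h x ∂Measure.infinitePi μ ≤ ∑ i ∈ s, D i := by
  induction s using Finset.induction_on generalizing h C with
  | empty =>
    have hconst : ∀ x, Real.exp (h x) = ∫ y, Real.exp (h y) ∂Measure.infinitePi μ := fun x => by
      have hxy : ∀ y, h y = h x := fun y => hdep fun _ hi => absurd hi (Finset.notMem_empty _)
      simp only [hxy, integral_const, probReal_univ, one_smul]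
    refine integral_nonpos fun x => mul_nonpos_of_nonneg_of_nonpos (hG0 x) ?_
    exact Real.exp_le_one_iff.1 ((hconst x).trans_le hexp)
  | insert i s hi ih =>
    obtain ⟨H, hmH, hbH, hdepH, hexpH, hexpsub⟩ :=
      exists_dependsOn_integral_exp_sub_update_le_one hi hm hb hdep hexp
    have hbsub : ∀ x, |h x - H x| ≤ C + C := fun x =>
      (abs_sub _ _).trans (add_le_add (hb x) (hbH x))
    have hsub := hD i (Finset.mem_insert_self i s) _ (hm.sub hmH) _ hbsub hexpsub
    have hH := ih (fun j hj => hD j (Finset.mem_insert_of_mem hj)) hmH hbH hdepH hexpH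
    have hGsub : Integrable (fun x => G x * (h x - H x)) (Measure.infinitePi μ) :=
      hG.mul_bdd (hm.sub hmH).aestronglyMeasurable (.of_forall hbsub)
    have hGH : Integrable (fun x => G x * H x) (Measure.infinitePi μ) :=
      hG.mul_bdd hmH.aestronglyMeasurable (.of_forall hbH)
    rw [Finset.sum_insert hi]
    refine le_trans (le_of_eq ?_) (add_le_add hsub hH)
    change _ = ∫ x, G x * (h x - H x) ∂_ + ∫ x, G x * H x ∂_
    rw [← integral_add hGsub hGH]
    simp only [← mul_add, sub_add_cancel]

theorem integral_mul_avgOutside_update {i : ι} (hi : i ∈ s) {G : X i → ℝ} (hG : Measurable G)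
    {C : ℝ} (hC : ∀ t, |G t| ≤ C) {x : ∀ j, X j}
    (hx : Integrable (fun y => f ((s.erase i).piecewise x y)) (Measure.infinitePi μ)) :
    ∫ t, G t * avgOutside μ s f (update x i t) ∂μ i =
      ∫ y, ∫ t, G t * f (update (s.piecewise x y) i t) ∂μ i ∂Measure.infinitePi μ := by
  simp only [avgOutside, ← integral_const_mul, ← Finset.update_piecewise_of_mem _ _ _ hi,
    update_piecewise_eq_erase_piecewise hi]
  exact integral_integral_swap ((integrable_comp_update hx i).bdd_mul
    (hG.comp measurable_snd).aestronglyMeasurable (.of_forall fun z => hC z.2)) |>.symm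

end CoordinateAverage

section EntropyLowerBound

open Filter Topology Real

/-- A bounded measurable function of `y`, bounded away from `0`, that tends to `|y|` as `ε → 0`. -/
noncomputable def clampAbs (ε y : ℝ) : ℝ := min |y| ε⁻¹ + ε

theorem continuous_clampAbs (ε : ℝ) : Continuous (clampAbs ε) :=
  (continuous_abs.min continuous_const).add_const ε

theorem clampAbs_le_abs_add (ε y : ℝ) : clampAbs ε y ≤ |y| + ε := by
  grw [clampAbs, min_le_left]

variable {ε : ℝ} (hε : 0 < ε)
include hε

theorem clampAbs_mem_Icc (y : ℝ) : clampAbs ε y ∈ Icc ε (ε⁻¹ + ε) :=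
  ⟨le_add_of_nonneg_left (le_min (abs_nonneg y) (inv_pos.2 hε).le), by grw [clampAbs, min_le_right]⟩

theorem clampAbs_pos (y : ℝ) : 0 < clampAbs ε y :=
  hε.trans_le (clampAbs_mem_Icc hε y).1

theorem abs_log_clampAbs_le (y : ℝ) : |log (clampAbs ε y)| ≤ max |log ε| |log (ε⁻¹ + ε)| :=
  abs_le_max_abs_abs (log_le_log hε (clampAbs_mem_Icc hε y).1)
    (log_le_log (clampAbs_pos hε y) (clampAbs_mem_Icc hε y).2)

theorem sq_div_clampAbs_le (y : ℝ) : y ^ 2 / clampAbs ε y ≤ |y| + y ^ 2 * ε := by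
  rw [div_le_iff₀ (clampAbs_pos hε y), ← sq_abs, clampAbs]
  rcases le_total |y| ε⁻¹ with h | h
  · rw [min_eq_left h]
    have : 0 ≤ |y| * ε + |y| ^ 2 * ε * (|y| + ε) := by positivity
    linarith
  · rw [min_eq_right h]
    have hcancel : |y| ^ 2 * ε * ε⁻¹ = |y| ^ 2 := mul_inv_cancel_right₀ hε.ne' _
    have : 0 ≤ |y| * (ε⁻¹ + ε) + |y| ^ 2 * ε * ε := by positivity
    linarith

theorem sq_mul_log_clampAbs_ge {a : ℝ} (ha : 0 < a) (y : ℝ) :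
    y ^ 2 * (log a + 1) - a * (|y| + y ^ 2 * ε) ≤ y ^ 2 * log (clampAbs ε y) := by
  have hv := clampAbs_pos hε y
  have hlog : log a + 1 - a / clampAbs ε y ≤ log (clampAbs ε y) := by
    have := log_le_sub_one_of_pos (div_pos ha hv)
    rw [log_div ha.ne' hv.ne'] at this
    linarith
  calc y ^ 2 * (log a + 1) - a * (|y| + y ^ 2 * ε)
      ≤ y ^ 2 * (log a + 1) - a * (y ^ 2 / clampAbs ε y) := by grw [sq_div_clampAbs_le hε y]
    _ = y ^ 2 * (log a + 1 - a / clampAbs ε y) := by ring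
    _ ≤ y ^ 2 * log (clampAbs ε y) := by grw [hlog]

variable {Ω : Type*} [MeasurableSpace Ω] {ν : Measure Ω} [IsProbabilityMeasure ν] {g : Ω → ℝ}
  (hg : MemLp g 2 ν)
include hg

theorem integral_sq_clampAbs_le :
    ∫ x, clampAbs ε (g x) ^ 2 ∂ν ≤ ∫ x, g x ^ 2 ∂ν + 2 * ε * ∫ x, |g x| ∂ν + ε ^ 2 := by
  have habs := (hg.integrable one_le_two).abs
  have hint : Integrable (fun x => g x ^ 2 + 2 * ε * |g x|) ν :=
    hg.integrable_sq.add (habs.const_mul _)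
  calc ∫ x, clampAbs ε (g x) ^ 2 ∂ν ≤ ∫ x, (g x ^ 2 + 2 * ε * |g x| + ε ^ 2) ∂ν := by
        refine integral_mono_of_nonneg (.of_forall fun _ => sq_nonneg _)
          (hint.add (integrable_const _)) (.of_forall fun x => ?_)
        have := pow_le_pow_left₀ (clampAbs_pos hε (g x)).le (clampAbs_le_abs_add ε (g x)) 2
        calc clampAbs ε (g x) ^ 2 ≤ (|g x| + ε) ^ 2 := this
          _ = g x ^ 2 + 2 * ε * |g x| + ε ^ 2 := by rw [← sq_abs (g x)]; ring
    _ = ∫ x, g x ^ 2 ∂ν + 2 * ε * ∫ x, |g x| ∂ν + ε ^ 2 := by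
        rw [integral_add hint (integrable_const _),
          integral_add hg.integrable_sq (habs.const_mul _), integral_const_mul, integral_const,
          probReal_univ, one_smul]

omit hε

variable {R : ℝ} (hR : ∀ φ : ℝ → ℝ, Measurable φ → ∀ C, (∀ y, |φ y| ≤ C) →
  ∫ x, exp (φ (g x)) ∂ν ≤ 1 → ∫ x, g x ^ 2 * φ (g x) ∂ν ≤ R)
include hR

theorem two_mul_sub_mul_log_le_of_pos (hε : 0 < ε) {a : ℝ} (ha : 0 < a) :
    2 * ((∫ x, g x ^ 2 ∂ν) * (log a + 1) - a * (∫ x, |g x| ∂ν + (∫ x, g x ^ 2 ∂ν) * ε)) -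
      (∫ x, g x ^ 2 ∂ν) * log (∫ x, g x ^ 2 ∂ν + 2 * ε * ∫ x, |g x| ∂ν + ε ^ 2) ≤ R := by
  have hsq := hg.integrable_sq
  have habs := (hg.integrable one_le_two).abs
  set c := ∫ x, g x ^ 2 ∂ν + 2 * ε * ∫ x, |g x| ∂ν + ε ^ 2
  have hc : 0 < c := by positivity
  let φ : ℝ → ℝ := fun y => 2 * log (clampAbs ε y) - log c
  have hφ : Measurable φ :=
    ((continuous_clampAbs ε).measurable.log.const_mul 2).sub_const (log c)
  have hφb : ∀ y, |φ y| ≤ 2 * max |log ε| |log (ε⁻¹ + ε)| + |log c| := fun y => by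
    grw [abs_sub, abs_mul, abs_two, abs_log_clampAbs_le hε]
  have hexp : ∫ x, exp (φ (g x)) ∂ν ≤ 1 := by
    have hφexp : ∀ y, exp (φ y) = clampAbs ε y ^ 2 / c := fun y => by
      rw [exp_sub, exp_log hc, two_mul, exp_add, exp_log (clampAbs_pos hε y), sq]
    simp only [hφexp]
    rw [integral_div, div_le_one hc]
    exact integral_sq_clampAbs_le hε hg
  have hlow : ∀ y, 2 * (y ^ 2 * (log a + 1) - a * (|y| + y ^ 2 * ε)) - y ^ 2 * log c ≤
      y ^ 2 * φ y := fun y => by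
    grw [sq_mul_log_clampAbs_ge hε ha y]
    exact le_of_eq (by ring)
  have hlin : Integrable (fun x => |g x| + g x ^ 2 * ε) ν := habs.add (hsq.mul_const ε)
  have hdiff : Integrable (fun x => g x ^ 2 * (log a + 1) - a * (|g x| + g x ^ 2 * ε)) ν :=
    (hsq.mul_const _).sub (hlin.const_mul a)
  refine le_trans (le_trans (le_of_eq ?_) (integral_mono ((hdiff.const_mul 2).sub
    (hsq.mul_const (log c))) (hsq.mul_bdd
      (hφ.comp_aemeasurable hg.1.aemeasurable).aestronglyMeasurable
      (.of_forall fun x => hφb (g x))) fun x => hlow (g x))) (hR φ hφ _ hφb hexp)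
  simp only [Pi.sub_apply]
  rw [integral_sub (hdiff.const_mul 2) (hsq.mul_const _), integral_const_mul,
    integral_sub (hsq.mul_const _) (hlin.const_mul a), integral_mul_const, integral_const_mul,
    integral_add habs (hsq.mul_const ε), integral_mul_const, integral_mul_const]

theorem two_mul_sub_mul_log_le (hA : 0 < ∫ x, g x ^ 2 ∂ν) {a : ℝ} (ha : 0 < a) :
    2 * ((∫ x, g x ^ 2 ∂ν) * (log a + 1) - a * ∫ x, |g x| ∂ν) -
      (∫ x, g x ^ 2 ∂ν) * log (∫ x, g x ^ 2 ∂ν) ≤ R := by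
  set A := ∫ x, g x ^ 2 ∂ν
  set b := ∫ x, |g x| ∂ν
  have hcont : ContinuousAt (fun ε : ℝ => 2 * (A * (log a + 1) - a * (b + A * ε)) -
      A * log (A + 2 * ε * b + ε ^ 2)) 0 :=
    .sub (by fun_prop) (continuousAt_const.mul (.log (by fun_prop) (by simpa using hA.ne')))
  have hlim := hcont.tendsto.mono_left (nhdsWithin_le_nhds (s := Ioi 0))
  refine le_trans (le_of_eq (by simp)) (le_of_tendsto hlim
    (eventually_of_mem self_mem_nhdsWithin fun ε hε => ?_))
  exact two_mul_sub_mul_log_le_of_pos hg hR hε ha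

/-- A linearised lower bound for the entropy of `g ^ 2`: by Jensen's inequality that entropy is at
least `A * log (A / b ^ 2)`, where `A = ∫ g ^ 2` and `b = ∫ |g|`, and
`A * log (A / b ^ 2) ≥ A * log θ + A - θ * b ^ 2` for every `θ`. -/
theorem integral_sq_mul_log_add_sub_le {θ : ℝ} (hθ : 0 < θ) :
    (∫ x, g x ^ 2 ∂ν) * log θ + ∫ x, g x ^ 2 ∂ν - θ * (∫ x, |g x| ∂ν) ^ 2 ≤ R := by
  have hA : 0 ≤ ∫ x, g x ^ 2 ∂ν := integral_nonneg fun _ => sq_nonneg _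
  have hR0 : 0 ≤ R := by
    simpa using hR (fun _ => 0) measurable_const 0 (by simp) (by simp)
  have hlin := two_mul_sub_mul_log_le hg hR (a := √((∫ x, g x ^ 2 ∂ν) * θ))
  set A := ∫ x, g x ^ 2 ∂ν
  set b := ∫ x, |g x| ∂ν
  rcases hA.eq_or_lt with hA0 | hA0
  · rw [← hA0]
    have : 0 ≤ θ * b ^ 2 := by positivity
    linarith
  have hAθ : 0 < A * θ := mul_pos hA0 hθ
  have hlog : 2 * log √(A * θ) = log A + log θ := by
    rw [log_sqrt hAθ.le, log_mul hA0.ne' hθ.ne']; ring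
  have hamgm : 2 * √(A * θ) * b ≤ A + θ * b ^ 2 := by
    rw [sqrt_mul hA]
    nlinarith [sq_nonneg (√A - √θ * b), sq_sqrt hA, sq_sqrt hθ.le]
  have hlin := hlin hA0 (sqrt_pos.2 hAθ)
  calc A * log θ + A - θ * b ^ 2
      ≤ A * log θ + 2 * A - 2 * √(A * θ) * b := by linarith
    _ = 2 * (A * (log √(A * θ) + 1) - √(A * θ) * b) - A * log A := by linear_combination -A * hlog
    _ ≤ R := hlin

end EntropyLowerBound

section WeakPartialDerivative

open Filter Function Topology Real

instance : IsProbabilityMeasure uniformProd :=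
  inferInstanceAs (IsProbabilityMeasure (Measure.infinitePi _))

theorem hasWeakDerivUnit_const (c : ℝ) : HasWeakDerivUnit (fun _ => c) fun _ => 0 := by
  refine ⟨(integrable_const c).locallyIntegrable.locallyIntegrableOn _,
    (integrable_const 0).locallyIntegrable.locallyIntegrableOn _, fun g hg _ hs => ?_⟩
  have hzero : ∀ x, x ∉ Ioo (0 : ℝ) 1 → g x = 0 := fun x hx =>
    image_eq_zero_of_notMem_tsupport fun h => hx (hs h)
  rw [integral_mul_const, integral_unitInterval_eq_intervalIntegral (deriv g),
    intervalIntegral.integral_deriv_eq_sub (fun x _ => hg.differentiable (by simp) x)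
      ((hg.continuous_deriv (by simp)).intervalIntegrable _ _), hzero 0 (by simp),
    hzero 1 (by simp)]
  simp

theorem HasWeakDerivUnit.sub {u u' v v' : I → ℝ} (hu : Integrable u) (hu' : Integrable u')
    (hv : Integrable v) (hv' : Integrable v') (huu' : HasWeakDerivUnit u u')
    (hvv' : HasWeakDerivUnit v v') :
    HasWeakDerivUnit (fun t => u t - v t) fun t => u' t - v' t := by
  refine ⟨huu'.1.sub hvv'.1, huu'.2.1.sub hvv'.2.1, fun g hg hgc hgs => ?_⟩
  have hmul : ∀ {G : ℝ → ℝ} {F : I → ℝ}, Continuous G → Integrable F →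
      Integrable fun t : I => G t * F t := fun {G F} hG hF => by
    obtain ⟨C, hC⟩ := isCompact_univ.exists_bound_of_continuousOn (f := fun t : I => G t)
      (by fun_prop)
    exact hF.bdd_mul (Continuous.aestronglyMeasurable (by fun_prop))
      (.of_forall fun t => hC t (mem_univ t))
  have hg' := hg.continuous_deriv (by simp)
  simp only [mul_sub]
  rw [integral_sub (hmul hg' hu) (hmul hg' hv),
    integral_sub (hmul hg.continuous hu') (hmul hg.continuous hv'),
    huu'.2.2 g hg hgc hgs, hvv'.2.2 g hg hgc hgs]
  ring

theorem update_ae_eq {f g : (ℕ → I) → ℝ} (h : f =ᵐ[uniformProd] g) (i : ℕ) :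
    ∀ᵐ x ∂uniformProd, (fun t => f (update x i t)) =ᵐ[volume] fun t => g (update x i t) :=
  Measure.ae_ae_of_ae_prod
    ((measurePreserving_update (fun _ : ℕ => (volume : Measure I)) i).quasiMeasurePreserving.ae h)

theorem HasWeakPartialDeriv.congr_ae {i : ℕ} {f g h : (ℕ → I) → ℝ}
    (hfh : HasWeakPartialDeriv i f h) (hfg : f =ᵐ[uniformProd] g) : HasWeakPartialDeriv i g h := by
  filter_upwards [hfh, update_ae_eq hfg i] with x hx hxe
  refine ⟨hx.1.congr (ae_restrict_of_ae hxe), hx.2.1, fun φ hφ hφc hφs => ?_⟩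
  rw [← hx.2.2 φ hφ hφc hφs]
  exact integral_congr_ae (hxe.symm.mono fun t ht => congrArg (deriv φ t * ·) ht)

theorem HasWeakPartialDeriv.sub {i : ℕ} {f f' g g' : (ℕ → I) → ℝ}
    (hf : Integrable f uniformProd) (hf' : Integrable f' uniformProd)
    (hg : Integrable g uniformProd) (hg' : Integrable g' uniformProd)
    (hff' : HasWeakPartialDeriv i f f') (hgg' : HasWeakPartialDeriv i g g') :
    HasWeakPartialDeriv i (fun x => f x - g x) fun x => f' x - g' x := by
  filter_upwards [hff', hgg', integrable_update_ae hf i, integrable_update_ae hf' i,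
    integrable_update_ae hg i, integrable_update_ae hg' i] with x hfx hgx hxf hxf' hxg hxg'
  exact .sub hxf hxf' hxg hxg' hfx hgx

theorem HasWeakPartialDeriv.avgOutside_of_mem {s : Finset ℕ} {i : ℕ} (hi : i ∈ s)
    {f h : (ℕ → I) → ℝ} (hf : Integrable f uniformProd) (hh : Integrable h uniformProd)
    (hfh : HasWeakPartialDeriv i f h) :
    HasWeakPartialDeriv i (avgOutside (fun _ => volume) s f)
      (avgOutside (fun _ => volume) s h) := by
  have hslice : ∀ᵐ x ∂uniformProd, ∀ᵐ y ∂uniformProd,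
      HasWeakDerivUnit (fun t => f (update (s.piecewise x y) i t))
        fun t => h (update (s.piecewise x y) i t) :=
    Measure.ae_ae_of_ae_prod ((measurePreserving_finsetPiecewise
      (fun _ : ℕ => (volume : Measure I)) s).quasiMeasurePreserving.ae hfh)
  filter_upwards [hslice, integrable_finsetPiecewise_ae hf (s.erase i),
    integrable_finsetPiecewise_ae hh (s.erase i),
    integrable_update_ae (integrable_avgOutside hf s) i,
    integrable_update_ae (integrable_avgOutside hh s) i] with x hx hxf hxh hxf' hxh'
  refine ⟨hxf'.locallyIntegrable.locallyIntegrableOn _,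
    hxh'.locallyIntegrable.locallyIntegrableOn _, fun g hg hgc hgs => ?_⟩
  have hswap : ∀ {G : ℝ → ℝ} {F : (ℕ → I) → ℝ}, Continuous G →
      Integrable (fun y => F ((s.erase i).piecewise x y)) uniformProd →
        ∫ t : I, G t * avgOutside (fun _ => volume) s F (update x i t) =
          ∫ y, (∫ t : I, G t * F (update (s.piecewise x y) i t)) ∂uniformProd := by
    intro G F hG hF
    obtain ⟨C, hC⟩ := isCompact_univ.exists_bound_of_continuousOn (f := fun t : I => G t)
      (by fun_prop)
    exact integral_mul_avgOutside_update hi (G := fun t : I => G t) (by fun_prop)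
      (fun t => hC t (mem_univ t)) hF
  rw [hswap (hg.continuous_deriv (by simp)) hxf, hswap hg.continuous hxh, ← integral_neg]
  exact integral_congr_ae (hx.mono fun y hy => hy.2.2 g hg hgc hgs)

theorem hasWeakPartialDeriv_avgOutside_of_notMem {s : Finset ℕ} {i : ℕ} (hi : i ∉ s)
    (f : (ℕ → I) → ℝ) :
    HasWeakPartialDeriv i (avgOutside (fun _ => volume) s f) fun _ => 0 :=
  .of_forall fun x => by
    simp only [avgOutside_update _ hi]
    exact hasWeakDerivUnit_const _

theorem HasWeakPartialDeriv.integral_sq_mul_le {i : ℕ} {g w L : (ℕ → I) → ℝ}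
    (hgw : HasWeakPartialDeriv i g w) (hg : MemLp g 2 uniformProd) (hw : MemLp w 2 uniformProd)
    (hm : Measurable L) {C : ℝ} (hb : ∀ x, |L x| ≤ C)
    (hexp : ∀ x, ∫ t, exp (L (update x i t)) ≤ 1) :
    ∫ x, g x ^ 2 * L x ∂uniformProd ≤ 2 / π ^ 2 * ∫ x, w x ^ 2 ∂uniformProd := by
  have hgL : Integrable (fun x => g x ^ 2 * L x) uniformProd :=
    hg.integrable_sq.mul_bdd hm.aestronglyMeasurable (.of_forall hb)
  calc ∫ x, g x ^ 2 * L x ∂uniformProd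
      = ∫ x, (∫ t, g (update x i t) ^ 2 * L (update x i t)) ∂uniformProd :=
        (integral_integral_update hgL i).symm
    _ ≤ ∫ x, 2 / π ^ 2 * (∫ t, w (update x i t) ^ 2) ∂uniformProd := by
        refine integral_mono_ae (integrable_integral_update hgL i)
          ((integrable_integral_update hw.integrable_sq i).const_mul _) ?_
        filter_upwards [hgw, memLp_update_ae hg i, memLp_update_ae hw i] with x hx hxg hxw
        exact hx.integral_sq_mul_le hxg hxw (hm.comp (measurable_update x)) (fun t => hb _) (hexp x)
    _ = 2 / π ^ 2 * ∫ x, w x ^ 2 ∂uniformProd := by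
        rw [integral_const_mul]
        exact congrArg _ (integral_integral_update hw.integrable_sq i)

/-- The logarithmic Sobolev inequality for functions of finitely many coordinates, with the entropy
of `g ^ 2` replaced by its linearised lower bound. -/
theorem integral_sq_mul_log_add_sub_le_of_hasWeakPartialDeriv {s : Finset ℕ} {g : (ℕ → I) → ℝ}
    {w : ℕ → (ℕ → I) → ℝ} (hm : Measurable g) (hg : MemLp g 2 uniformProd) (hdep : DependsOn g s)
    (hw : ∀ i ∈ s, MemLp (w i) 2 uniformProd) (hgw : ∀ i ∈ s, HasWeakPartialDeriv i g (w i))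
    {θ : ℝ} (hθ : 0 < θ) :
    (∫ x, g x ^ 2 ∂uniformProd) * log θ + ∫ x, g x ^ 2 ∂uniformProd -
      θ * (∫ x, |g x| ∂uniformProd) ^ 2 ≤ ∑ i ∈ s, 2 / π ^ 2 * ∫ x, w i x ^ 2 ∂uniformProd := by
  refine integral_sq_mul_log_add_sub_le hg (fun φ hφ C hC hexp => ?_) hθ
  exact integral_mul_le_sum_of_forall_update hg.integrable_sq (fun _ => sq_nonneg _)
    (fun i hi L hL C hC hLexp => (hgw i hi).integral_sq_mul_le hg (hw i hi) hL hC hLexp)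
    (hφ.comp hm) (fun x => hC (g x)) (fun x y hxy => congrArg φ (hdep hxy)) hexp

end WeakPartialDerivative

section MartingaleDifferences

open Filter Topology Real

theorem coordDelta_congr_ae {f g : (ℕ → I) → ℝ} (h : f =ᵐ[uniformProd] g) (i : ℕ) :
    coordDelta i f =ᵐ[uniformProd] coordDelta i g := by
  filter_upwards [h, update_ae_eq h i] with x hx hslice
  simp only [coordDelta, hx, integral_congr_ae hslice]

theorem integrable_coordDelta {f : (ℕ → I) → ℝ} (hf : Integrable f uniformProd) (i : ℕ) :
    Integrable (coordDelta i f) uniformProd :=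
  hf.sub (integrable_integral_update hf i)

/-- The average of `f` over all coordinates but the first `n`: the martingale whose increments
decompose `f`. -/
noncomputable def headAvg (n : ℕ) (f : (ℕ → I) → ℝ) : (ℕ → I) → ℝ :=
  avgOutside (fun _ => (volume : Measure I)) (Finset.range n) f

/-- The weak partial derivative of `headAvg n f` in the `i`-th coordinate, when `h` is that of
`f`. -/
noncomputable def headAvgDeriv (i n : ℕ) (h : (ℕ → I) → ℝ) : (ℕ → I) → ℝ :=
  if i < n then headAvg n h else 0

theorem dependsOn_headAvg (n : ℕ) (f : (ℕ → I) → ℝ) : DependsOn (headAvg n f) (Finset.range n) :=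
  dependsOn_avgOutside _ _ f

theorem measurable_headAvg {f : (ℕ → I) → ℝ} (hf : Measurable f) (n : ℕ) :
    Measurable (headAvg n f) :=
  (measurable_avgOutside hf _).mono (Filtration.piFinset.le _) le_rfl

section SquareIntegrable

variable {f h : (ℕ → I) → ℝ} (hf : MemLp f 2 uniformProd) (hh : MemLp h 2 uniformProd)

include hf in
theorem memLp_headAvg (n : ℕ) : MemLp (headAvg n f) 2 uniformProd :=
  memLp_avgOutside hf _

include hf in
theorem integral_sq_headAvg_succ_sub (n : ℕ) :
    ∫ x, (headAvg (n + 1) f x - headAvg n f x) ^ 2 ∂uniformProd =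
      ∫ x, headAvg (n + 1) f x ^ 2 ∂uniformProd - ∫ x, headAvg n f x ^ 2 ∂uniformProd :=
  integral_sq_avgOutside_sub (Finset.range_mono n.le_succ) hf

include hf in
theorem integral_abs_headAvg_succ_sub_le (n : ℕ) :
    ∫ x, |headAvg (n + 1) f x - headAvg n f x| ∂uniformProd ≤
      ∫ x, |coordDelta n f x| ∂uniformProd := by
  simp only [headAvg, Finset.range_add_one]
  exact integral_abs_avgOutside_insert_sub_le Finset.notMem_range_self (hf.integrable one_le_two)

theorem tendsto_integral_sq_headAvg (hm : Measurable f) (hf : MemLp f 2 uniformProd) :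
    Tendsto (fun n => ∫ x, headAvg n f x ^ 2 ∂uniformProd) atTop
      (𝓝 (∫ x, f x ^ 2 ∂uniformProd)) :=
  tendsto_integral_sq_avgOutside Finset.range_mono (fun i => ⟨i + 1, Finset.self_mem_range_succ i⟩)
    hm hf

include hh in
theorem memLp_headAvgDeriv (i n : ℕ) : MemLp (headAvgDeriv i n h) 2 uniformProd := by
  unfold headAvgDeriv
  split_ifs
  exacts [memLp_headAvg hh n, .zero]

include hh in
theorem integral_sq_headAvgDeriv_le (i n : ℕ) :
    ∫ x, headAvgDeriv i n h x ^ 2 ∂uniformProd ≤ ∫ x, h x ^ 2 ∂uniformProd := by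
  unfold headAvgDeriv
  split_ifs
  · exact integral_sq_avgOutside_le hh _
  · simpa using integral_nonneg fun x => sq_nonneg (h x)

include hh in
theorem integral_sq_headAvgDeriv_succ_sub (i n : ℕ) :
    ∫ x, (headAvgDeriv i (n + 1) h x - headAvgDeriv i n h x) ^ 2 ∂uniformProd =
      ∫ x, headAvgDeriv i (n + 1) h x ^ 2 ∂uniformProd -
        ∫ x, headAvgDeriv i n h x ^ 2 ∂uniformProd := by
  by_cases hi : i < n
  · simpa only [headAvgDeriv, if_pos hi, if_pos (hi.trans n.lt_succ_self)] using
      integral_sq_headAvg_succ_sub hh n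
  · simp [headAvgDeriv, hi]

include hf hh

theorem hasWeakPartialDeriv_headAvg {i : ℕ} (hfh : HasWeakPartialDeriv i f h) (n : ℕ) :
    HasWeakPartialDeriv i (headAvg n f) (headAvgDeriv i n h) := by
  unfold headAvgDeriv
  split_ifs with hi
  · exact hfh.avgOutside_of_mem (Finset.mem_range.2 hi) (hf.integrable one_le_two)
      (hh.integrable one_le_two)
  · exact hasWeakPartialDeriv_avgOutside_of_notMem (by simpa using hi) f

theorem hasWeakPartialDeriv_headAvg_succ_sub {i : ℕ} (hfh : HasWeakPartialDeriv i f h) (n : ℕ) :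
    HasWeakPartialDeriv i (fun x => headAvg (n + 1) f x - headAvg n f x)
      fun x => headAvgDeriv i (n + 1) h x - headAvgDeriv i n h x :=
  .sub
    ((memLp_headAvg hf _).integrable one_le_two)
    ((memLp_headAvgDeriv hh _ _).integrable one_le_two)
    ((memLp_headAvg hf _).integrable one_le_two)
    ((memLp_headAvgDeriv hh _ _).integrable one_le_two)
    (hasWeakPartialDeriv_headAvg hf hh hfh _) (hasWeakPartialDeriv_headAvg hf hh hfh _)

end SquareIntegrable

variable {f : (ℕ → I) → ℝ} {df : ℕ → (ℕ → I) → ℝ} (hm : Measurable f) (hf : MemLp f 2 uniformProd)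
  (hdf2 : ∀ i, MemLp (df i) 2 uniformProd) (hdf : ∀ i, HasWeakPartialDeriv i f (df i))
include hm hf hdf2 hdf

theorem integral_sq_headAvg_succ_sub_mul_log_le {j n : ℕ} (hj : j < n) {θ : ℝ} (hθ : 0 < θ) :
    (∫ x, headAvg (j + 1) f x ^ 2 ∂uniformProd - ∫ x, headAvg j f x ^ 2 ∂uniformProd) *
        (log θ + 1) - θ * (∫ x, |coordDelta j f x| ∂uniformProd) ^ 2 ≤
      ∑ i ∈ Finset.range n, 2 / π ^ 2 * (∫ x, headAvgDeriv i (j + 1) (df i) x ^ 2 ∂uniformProd -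
        ∫ x, headAvgDeriv i j (df i) x ^ 2 ∂uniformProd) := by
  have hdep : ∀ k ≤ n, DependsOn (headAvg k f) (Finset.range n) := fun k hk =>
    (dependsOn_headAvg k f).mono (Finset.coe_subset.2 (Finset.range_mono hk))
  have hlogSobolev := integral_sq_mul_log_add_sub_le_of_hasWeakPartialDeriv (s := Finset.range n)
    ((measurable_headAvg hm (j + 1)).sub (measurable_headAvg hm j))
    ((memLp_headAvg hf (j + 1)).sub (memLp_headAvg hf j))
    (fun x y hxy => congrArg₂ (· - ·) (hdep _ hj hxy) (hdep _ hj.le hxy))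
    (fun i _ => (memLp_headAvgDeriv (hdf2 i) i (j + 1)).sub (memLp_headAvgDeriv (hdf2 i) i j))
    (fun i _ => hasWeakPartialDeriv_headAvg_succ_sub hf (hdf2 i) (hdf i) j) hθ
  simp only [Pi.sub_apply, integral_sq_headAvg_succ_sub hf,
    integral_sq_headAvgDeriv_succ_sub (hdf2 _)] at hlogSobolev
  grw [integral_abs_headAvg_succ_sub_le hf j] at hlogSobolev
  linarith

theorem integral_sq_headAvg_sub_mul_log_le (n : ℕ) {θ : ℝ} (hθ : 0 < θ) :
    (∫ x, headAvg n f x ^ 2 ∂uniformProd - ∫ x, headAvg 0 f x ^ 2 ∂uniformProd) * (log θ + 1) -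
        θ * ∑ j ∈ Finset.range n, (∫ x, |coordDelta j f x| ∂uniformProd) ^ 2 ≤
      2 / π ^ 2 * ∑ i ∈ Finset.range n, ∫ x, df i x ^ 2 ∂uniformProd := by
  have hsum := Finset.sum_le_sum fun j (hj : j ∈ Finset.range n) =>
    integral_sq_headAvg_succ_sub_mul_log_le hm hf hdf2 hdf (Finset.mem_range.1 hj) hθ
  rw [Finset.sum_sub_distrib, ← Finset.sum_mul,
    Finset.sum_range_sub fun j => ∫ x, headAvg j f x ^ 2 ∂uniformProd, ← Finset.mul_sum,
    Finset.sum_comm] at hsum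
  refine hsum.trans ?_
  rw [Finset.mul_sum]
  refine Finset.sum_le_sum fun i _ => ?_
  rw [← Finset.mul_sum,
    Finset.sum_range_sub fun j => ∫ x, headAvgDeriv i j (df i) x ^ 2 ∂uniformProd]
  grw [integral_sq_headAvgDeriv_le (hdf2 i) i n]
  simp [headAvgDeriv]

theorem variance_mul_log_le {s d : ℝ}
    (hs : ∀ n, ∑ j ∈ Finset.range n, (∫ x, |coordDelta j f x| ∂uniformProd) ^ 2 ≤ s)
    (hd : ∀ n, ∑ i ∈ Finset.range n, ∫ x, df i x ^ 2 ∂uniformProd ≤ d) {θ : ℝ} (hθ : 0 < θ) :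
    variance f uniformProd * (log θ + 1) - θ * s ≤ 2 / π ^ 2 * d := by
  have hvar : Tendsto (fun n => ∫ x, headAvg n f x ^ 2 ∂uniformProd -
      ∫ x, headAvg 0 f x ^ 2 ∂uniformProd) atTop (𝓝 (variance f uniformProd)) := by
    have hzero : ∀ x, headAvg 0 f x = ∫ y, f y ∂uniformProd := avgOutside_empty _ f
    simp only [variance_eq_sub hf, hzero, integral_const, probReal_univ, one_smul]
    exact (tendsto_integral_sq_headAvg hm hf).sub_const _
  refine le_of_tendsto' ((hvar.mul_const (log θ + 1)).sub_const (θ * s)) fun n => ?_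
  have hmain := integral_sq_headAvg_sub_mul_log_le hm hf hdf2 hdf n hθ
  grw [hd n] at hmain
  grw [← hs n]
  exact hmain

end MartingaleDifferences

section ExtendedReals

open Real

theorem sum_le_toReal_tsum {a : ℕ → ℝ} {b : ℕ → ℝ≥0∞} (ha : ∀ i, 0 ≤ a i)
    (hb : ∀ i, b i = ENNReal.ofReal (a i)) (h : ∑' i, b i ≠ ⊤) (n : ℕ) :
    ∑ i ∈ Finset.range n, a i ≤ (∑' i, b i).toReal := by
  rw [← ENNReal.ofReal_le_iff_le_toReal h, ENNReal.ofReal_sum_of_nonneg fun i _ => ha i]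
  simp only [← hb]
  exact ENNReal.sum_le_tsum _

theorem pos_of_forall_mul_log_le {V s c : ℝ} (hV : 0 < V) (hs : 0 ≤ s)
    (h : ∀ θ, 0 < θ → V * (log θ + 1) - θ * s ≤ c) : 0 < s := by
  refine hs.lt_of_ne' fun hs0 => ?_
  have hexp := h (exp (c / V)) (exp_pos _)
  rw [log_exp, hs0, mul_add, mul_div_cancel₀ _ hV.ne'] at hexp
  linarith

theorem mul_log_div_le_of_forall_mul_log_le {V s c : ℝ} (hV : 0 < V) (hs : 0 < s)
    (h : ∀ θ, 0 < θ → V * (log θ + 1) - θ * s ≤ c) : V * log (V / s) ≤ c := by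
  have hopt := h (V / s) (div_pos hV hs)
  rw [div_mul_cancel₀ _ hs.ne'] at hopt
  linarith

theorem ereal_mul_log_div_le {V S C : ℝ≥0∞} (hV : V ≠ ⊤)
    (h : S ≠ ⊤ → C ≠ ⊤ → ∀ θ, 0 < θ → V.toReal * (log θ + 1) - θ * S.toReal ≤ C.toReal) :
    (V : EReal) * ENNReal.log (V / S) ≤ (C : EReal) := by
  rcases eq_or_ne V 0 with rfl | hV0
  · rw [EReal.coe_ennreal_zero, zero_mul]
    exact EReal.coe_ennreal_nonneg C
  rcases eq_or_ne S ⊤ with rfl | hS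
  · have hVpos : (0 : EReal) < V := by simpa using pos_iff_ne_zero.2 hV0
    rw [ENNReal.div_top, ENNReal.log_zero, EReal.mul_bot_of_pos hVpos]
    exact bot_le
  rcases eq_or_ne C ⊤ with rfl | hC
  · exact le_top
  have hVpos := ENNReal.toReal_pos hV0 hV
  have hSpos := pos_of_forall_mul_log_le hVpos ENNReal.toReal_nonneg (h hS hC)
  have hreal := mul_log_div_le_of_forall_mul_log_le hVpos hSpos (h hS hC)
  rw [← ENNReal.ofReal_toReal hV, ← ENNReal.ofReal_toReal hS, ← ENNReal.ofReal_toReal hC,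
    ← ENNReal.ofReal_div_of_pos hSpos, ENNReal.log_ofReal_of_pos (div_pos hVpos hSpos),
    EReal.coe_ennreal_ofReal, EReal.coe_ennreal_ofReal, max_eq_left hVpos.le,
    max_eq_left ENNReal.toReal_nonneg, ← EReal.coe_mul, EReal.coe_le_coe_iff]
  exact hreal

theorem sq_eLpNorm_one_eq_ofReal {α : Type*} [MeasurableSpace α] {ν : Measure α} {g : α → ℝ}
    (hg : Integrable g ν) : eLpNorm g 1 ν ^ 2 = ENNReal.ofReal ((∫ x, |g x| ∂ν) ^ 2) := by
  simp only [eLpNorm_one_eq_lintegral_enorm, ← ofReal_integral_norm_eq_lintegral_enorm hg,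
    Real.norm_eq_abs, ENNReal.ofReal_pow (integral_nonneg fun x => abs_nonneg (g x))]

end ExtendedReals

/- The inequality is read in `[-∞, +∞]`, so that no summability of the two series is assumed: both
series are sums in `[0, +∞]`, `log 0 = -∞`, and the left-hand side is `0` if the variance is `0`. -/
theorem mainTheorem8 (f : (ℕ → I) → ℝ) (hf : MemLp f 2 uniformProd)
    (df : ℕ → (ℕ → I) → ℝ) (hdf : ∀ i, HasWeakPartialDeriv i f (df i))
    (hdf2 : ∀ i, MemLp (df i) 2 uniformProd) :
    ((evariance f uniformProd : ℝ≥0∞) : EReal) *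
        ENNReal.log
          (evariance f uniformProd / ∑' i : ℕ, eLpNorm (coordDelta i f) 1 uniformProd ^ 2) ≤
      ((ENNReal.ofReal (2 / Real.pi ^ 2) *
          ∑' i : ℕ, ∫⁻ x, ENNReal.ofReal (df i x ^ 2) ∂uniformProd : ℝ≥0∞) : EReal) := by
  have hπ : (0 : ℝ) < 2 / Real.pi ^ 2 := by positivity
  obtain ⟨g, hg, hfg⟩ := hf.1.aemeasurable
  have hg2 : MemLp g 2 uniformProd := hf.ae_eq hfg
  have hdelta : ∀ i, eLpNorm (coordDelta i f) 1 uniformProd ^ 2 =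
      ENNReal.ofReal ((∫ x, |coordDelta i g x| ∂uniformProd) ^ 2) := fun i => by
    rw [eLpNorm_congr_ae (coordDelta_congr_ae hfg i),
      sq_eLpNorm_one_eq_ofReal (integrable_coordDelta (hg2.integrable one_le_two) i)]
  have henergy : ∀ i, ∫⁻ x, ENNReal.ofReal (df i x ^ 2) ∂uniformProd =
      ENNReal.ofReal (∫ x, df i x ^ 2 ∂uniformProd) := fun i =>
    (ofReal_integral_eq_lintegral_ofReal (hdf2 i).integrable_sq
      (.of_forall fun _ => sq_nonneg _)).symm
  refine ereal_mul_log_div_le (evariance_lt_top hf).ne fun hS hC θ hθ => ?_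
  rw [evariance_congr hfg, ENNReal.toReal_mul, ENNReal.toReal_ofReal hπ.le]
  exact variance_mul_log_le hg hg2 hdf2 (fun i => (hdf i).congr_ae hfg)
    (sum_le_toReal_tsum (fun _ => sq_nonneg _) hdelta hS)
    (sum_le_toReal_tsum (fun _ => integral_nonneg fun _ => sq_nonneg _) henergy
      fun h => hC (by rw [h, ENNReal.mul_top (ENNReal.ofReal_pos.2 hπ).ne'])) hθ
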